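/- Let $\mathbb K\in\{\mathbb R,\mathbb C\}$. For integers $m,n\ge 1$ let $\mathscr O^m_n(\mathbb R)$ be the Banach space of all $f\in C^m(\mathbb R)$ ($\mathbb K$-valued) with $|f|_{m,n}=\sup_{x\in\mathbb R,\,0\le j\le m}(1+|x|^2)^{-n}|f^{(j)}(x)|<\infty$, let $\mathscr O^m(\mathbb R)=\bigcup_n\mathscr O^m_n(\mathbb R)$ carry the locally convex inductive limit topology, and let $\mathscr O_M(\mathbb R)=\bigcap_m\mathscr O^m(\mathbb R)$ carry the projective limit topology. Let $\mathscr S(\mathbb R)$ be the Schwartz space of ($\mathbb K$-valued) rapidly decreasing smooth functions. For $\psi:\mathbb R\to\mathbb R$ let $\psi_n$ denote the $n$-th iterate of $\psi$ and, if $\psi$ is injective, let $\psi_{-n}:\psi_n(\mathbb R)\to\mathbb R$ denote the inverse of $\psi_n$ ($n\ge 1$). A map $T:X\to X$ on a topological space is called mixing if for all non-empty open sets $U,V\subseteq X$ there is $N$ such that $T^n(U)\cap V\neq\emptyset$ for all $n\ge N$. Let $\psi\in\mathscr O_M(\mathbb R)$ be real-valued and not surjective. Then the following conditions are equivalent. (i)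 The composition operator $C_\psi:\mathscr O_M(\mathbb R)\to\mathscr O_M(\mathbb R)$, $f\mapsto f\circ\psi$, is mixing. (ii) $\psi$ is injective, has a non-vanishing derivative and no fixed points, and for every $a\in\mathbb R$, every integer $k\ge 1$ and every $v\in\mathscr S(\mathbb R)$, \[ \lim_{n\to\infty}\ \sup_{x\in\psi_n([\min\{a,\psi(a)\},\max\{a,\psi(a)\}])}\bigl|v(x)\,(\psi_{-n})^{(k)}(x)\bigr|=0. \] (iii) $\psi$ is injective, has a non-vanishing derivative and no fixed points, and there is $a\in\mathbb R$ such that for every integer $k\ge 1$ and every $v\in\mathscr S(\mathbb R)$, \[ \lim_{n\to\infty}\ \sup_{x\in\psi_n([\min\{a,\psi(a)\},\max\{a,\psi(a)\}])}\bigl|v(x)\,(\psi_{-n})^{(k)}(x)\bigr|=0. \] -/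

import Mathlib

open Filter Topology
open scoped ContDiff SchwartzMap

noncomputable section

namespace MultiplierSpace

/-- The quantities `(1 + |x|²)⁻ⁿ |f⁽ʲ⁾(x)|`, for `x ∈ ℝ` and `0 ≤ j ≤ m`. -/
def weighted {𝕜 : Type*} [RCLike 𝕜] (m n : ℕ) (f : ℝ → 𝕜) (p : ℝ × Fin (m + 1)) : ℝ :=
  ((1 + |p.1| ^ 2) ^ n)⁻¹ * ‖iteratedDeriv (p.2 : ℕ) f p.1‖

lemma weighted_nonneg {𝕜 : Type*} [RCLike 𝕜] (m n : ℕ) (f : ℝ → 𝕜) (p : ℝ × Fin (m + 1)) :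
    0 ≤ weighted m n f p := by
  unfold weighted
  positivity

lemma contDiffAt_of_fin {𝕜 : Type*} [RCLike 𝕜] {m : ℕ} {f : ℝ → 𝕜} (hf : ContDiff ℝ m f)
    (j : Fin (m + 1)) (x : ℝ) : ContDiffAt ℝ (j : ℕ) f x :=
  (hf.of_le (by exact_mod_cast Nat.lt_succ_iff.mp j.2)).contDiffAt

lemma weighted_add_le {𝕜 : Type*} [RCLike 𝕜] {m : ℕ} (n : ℕ) {f g : ℝ → 𝕜}
    (hf : ContDiff ℝ m f) (hg : ContDiff ℝ m g) (p : ℝ × Fin (m + 1)) :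
    weighted m n (f + g) p ≤ weighted m n f p + weighted m n g p := by
  unfold weighted
  rw [iteratedDeriv_add (contDiffAt_of_fin hf _ _) (contDiffAt_of_fin hg _ _), ← mul_add]
  gcongr
  exact norm_add_le _ _

lemma weighted_smul {𝕜 : Type*} [RCLike 𝕜] {m : ℕ} (n : ℕ) (c : 𝕜) (f : ℝ → 𝕜)
    (p : ℝ × Fin (m + 1)) : weighted m n (c • f) p = ‖c‖ * weighted m n f p := by
  unfold weighted
  rw [iteratedDeriv_const_smul_field, norm_smul]
  ring

lemma weighted_anti {𝕜 : Type*} [RCLike 𝕜] {m n n' : ℕ} (h : n ≤ n') (f : ℝ → 𝕜)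
    (p : ℝ × Fin (m + 1)) : weighted m n' f p ≤ weighted m n f p := by
  unfold weighted
  gcongr
  nlinarith [sq_nonneg |p.1|]

/-- The space `𝒪ₙᵐ(ℝ)` of all `f ∈ Cᵐ(ℝ)` with
`sup {(1 + |x|²)⁻ⁿ |f⁽ʲ⁾(x)| : x ∈ ℝ, 0 ≤ j ≤ m} < ∞`, as a subspace of all functions. -/
def stepSubmodule (𝕜 : Type*) [RCLike 𝕜] (m n : ℕ) : Submodule 𝕜 (ℝ → 𝕜) where
  carrier := {f | ContDiff ℝ m f ∧ BddAbove (Set.range (weighted m n f))}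
  zero_mem' := by
    refine ⟨contDiff_const, 0, ?_⟩
    rintro _ ⟨p, rfl⟩
    have := weighted_smul (m := m) n (0 : 𝕜) 0 p
    simp_all
  add_mem' := by
    rintro f g ⟨hf, A, hA⟩ ⟨hg, B, hB⟩
    refine ⟨hf.add hg, A + B, ?_⟩
    rintro _ ⟨p, rfl⟩
    exact (weighted_add_le n hf hg p).trans (add_le_add (hA ⟨p, rfl⟩) (hB ⟨p, rfl⟩))
  smul_mem' := by
    rintro c f ⟨hf, A, hA⟩
    refine ⟨hf.const_smul c, ‖c‖ * A, ?_⟩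
    rintro _ ⟨p, rfl⟩
    rw [weighted_smul]
    exact mul_le_mul_of_nonneg_left (hA ⟨p, rfl⟩) (norm_nonneg _)

/-- `𝒪ₙᵐ(ℝ)` as a type, to be equipped with the topology of its norm. -/
def Step (𝕜 : Type*) [RCLike 𝕜] (m n : ℕ) : Type _ := ↥(stepSubmodule 𝕜 m n)

instance (𝕜 : Type*) [RCLike 𝕜] (m n : ℕ) : AddCommGroup (Step 𝕜 m n) :=
  inferInstanceAs (AddCommGroup ↥(stepSubmodule 𝕜 m n))

instance (𝕜 : Type*) [RCLike 𝕜] (m n : ℕ) : Module 𝕜 (Step 𝕜 m n) :=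
  inferInstanceAs (Module 𝕜 ↥(stepSubmodule 𝕜 m n))

/-- The norm `|f|_{m,n} = sup {(1 + |x|²)⁻ⁿ |f⁽ʲ⁾(x)| : x ∈ ℝ, 0 ≤ j ≤ m}` of `𝒪ₙᵐ(ℝ)`. -/
def stepNorm (𝕜 : Type*) [RCLike 𝕜] (m n : ℕ) : AddGroupNorm (Step 𝕜 m n) where
  toFun f := ⨆ p, weighted m n f.1 p
  map_zero' := by
    have h : ∀ p, weighted m n (0 : ℝ → 𝕜) p = 0 := fun p => by
      have := weighted_smul (m := m) n (0 : 𝕜) 0 p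
      simp_all
    change ⨆ p, weighted m n (0 : ℝ → 𝕜) p = 0
    simp [h]
  add_le' f g := by
    refine ciSup_le fun p => (weighted_add_le n f.2.1 g.2.1 p).trans ?_
    exact add_le_add (le_ciSup f.2.2 p) (le_ciSup g.2.2 p)
  neg' f := by
    refine iSup_congr fun p => ?_
    have := weighted_smul n (-1 : 𝕜) f.1 p
    simp only [neg_smul, one_smul, norm_neg, norm_one, one_mul] at this
    exact this
  eq_zero_of_map_eq_zero' f hf := by
    refine Subtype.ext (funext fun x => ?_)
    have h : weighted m n f.1 (x, 0) ≤ 0 := (le_ciSup f.2.2 (x, 0)).trans hf.le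
    have h' := le_antisymm h (weighted_nonneg _ _ _ _)
    have hx : ((1 + |x| ^ 2) ^ n)⁻¹ ≠ 0 := by positivity
    have h0 := (mul_eq_zero.mp h').resolve_left hx
    rw [Fin.val_zero, iteratedDeriv_zero, norm_eq_zero] at h0
    exact h0

instance (𝕜 : Type*) [RCLike 𝕜] (m n : ℕ) : NormedAddCommGroup (Step 𝕜 m n) :=
  (stepNorm 𝕜 m n).toNormedAddCommGroup

/-- The union `𝒪ᵐ(ℝ)` of the spaces `𝒪ₙᵐ(ℝ)` over `n`. -/
def limSubmodule (𝕜 : Type*) [RCLike 𝕜] (m : ℕ) : Submodule 𝕜 (ℝ → 𝕜) where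
  carrier := {f | ∃ n, f ∈ stepSubmodule 𝕜 m n}
  zero_mem' := ⟨0, Submodule.zero_mem _⟩
  add_mem' := by
    have mono : ∀ {n n' : ℕ} {f : ℝ → 𝕜}, n ≤ n' → f ∈ stepSubmodule 𝕜 m n →
        f ∈ stepSubmodule 𝕜 m n' := by
      rintro n n' f h ⟨hf, A, hA⟩
      refine ⟨hf, A, ?_⟩
      rintro _ ⟨p, rfl⟩
      exact (weighted_anti h f p).trans (hA ⟨p, rfl⟩)
    rintro f g ⟨a, ha⟩ ⟨b, hb⟩
    exact ⟨max a b, Submodule.add_mem _ (mono (le_max_left a b) ha) (mono (le_max_right a b) hb)⟩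
  smul_mem' := fun c _ ⟨n, hn⟩ => ⟨n, Submodule.smul_mem _ c hn⟩

/-- `𝒪ᵐ(ℝ)` as a type, to be equipped with its inductive limit topology. -/
def Lim (𝕜 : Type*) [RCLike 𝕜] (m : ℕ) : Type _ := ↥(limSubmodule 𝕜 m)

instance (𝕜 : Type*) [RCLike 𝕜] (m : ℕ) : AddCommGroup (Lim 𝕜 m) :=
  inferInstanceAs (AddCommGroup ↥(limSubmodule 𝕜 m))

instance (𝕜 : Type*) [RCLike 𝕜] (m : ℕ) : Module 𝕜 (Lim 𝕜 m) :=
  inferInstanceAs (Module 𝕜 ↥(limSubmodule 𝕜 m))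

instance (𝕜 : Type*) [RCLike 𝕜] (m : ℕ) : Module ℝ (Lim 𝕜 m) :=
  inferInstanceAs (Module ℝ ↥(limSubmodule 𝕜 m))

/-- The inclusion `𝒪ₙᵐ(ℝ) → 𝒪ᵐ(ℝ)`. -/
def stepInclusion (𝕜 : Type*) [RCLike 𝕜] (m n : ℕ) (f : Step 𝕜 m n) : Lim 𝕜 m :=
  ⟨f.1, n, f.2⟩

/-- The locally convex inductive limit topology of `𝒪ᵐ(ℝ) = ind_n 𝒪ₙᵐ(ℝ)`: the finest locally
convex vector space topology for which all inclusions `𝒪ₙᵐ(ℝ) → 𝒪ᵐ(ℝ)` are continuous. -/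
instance (𝕜 : Type*) [RCLike 𝕜] (m : ℕ) : TopologicalSpace (Lim 𝕜 m) :=
  sInf {t : TopologicalSpace (Lim 𝕜 m) |
    @IsTopologicalAddGroup (Lim 𝕜 m) t _ ∧
    @ContinuousSMul 𝕜 (Lim 𝕜 m) _ _ t ∧
    @LocallyConvexSpace ℝ (Lim 𝕜 m) _ _ _ _ t ∧
    ∀ n, @Continuous (Step 𝕜 m n) (Lim 𝕜 m) _ t (stepInclusion 𝕜 m n)}

/-- The space `𝒪_M(ℝ) = ⋂ₘ ⋃ₙ 𝒪ₙᵐ(ℝ)`. -/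
def multiplierSubmodule (𝕜 : Type*) [RCLike 𝕜] : Submodule 𝕜 (ℝ → 𝕜) :=
  ⨅ m, limSubmodule 𝕜 m

lemma mem_multiplierSubmodule {𝕜 : Type*} [RCLike 𝕜] {f : ℝ → 𝕜} :
    f ∈ multiplierSubmodule 𝕜 ↔ ∀ m, ∃ n, f ∈ stepSubmodule 𝕜 m n := by
  rw [multiplierSubmodule, Submodule.mem_iInf]
  rfl

/-- `𝒪_M(ℝ)` as a type, to be equipped with its projective limit topology. -/
def OM (𝕜 : Type*) [RCLike 𝕜] : Type _ := ↥(multiplierSubmodule 𝕜)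

instance (𝕜 : Type*) [RCLike 𝕜] : AddCommGroup (OM 𝕜) :=
  inferInstanceAs (AddCommGroup ↥(multiplierSubmodule 𝕜))

instance (𝕜 : Type*) [RCLike 𝕜] : Module 𝕜 (OM 𝕜) :=
  inferInstanceAs (Module 𝕜 ↥(multiplierSubmodule 𝕜))

/-- The inclusion `𝒪_M(ℝ) → 𝒪ᵐ(ℝ)`. -/
def limInclusion (𝕜 : Type*) [RCLike 𝕜] (m : ℕ) (f : OM 𝕜) : Lim 𝕜 m :=
  ⟨f.1, mem_multiplierSubmodule.mp f.2 m⟩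

/-- The topology of `𝒪_M(ℝ)` as the projective limit of the spaces `𝒪ᵐ(ℝ)`. -/
instance (𝕜 : Type*) [RCLike 𝕜] : TopologicalSpace (OM 𝕜) :=
  ⨅ m, TopologicalSpace.induced (limInclusion 𝕜 m) inferInstance

lemma mem_multiplierSubmodule_iff_hasTemperateGrowth {𝕜 : Type*} [RCLike 𝕜] {f : ℝ → 𝕜} :
    f ∈ multiplierSubmodule 𝕜 ↔ f.HasTemperateGrowth := by
  rw [mem_multiplierSubmodule]
  constructor
  · intro h
    refine ⟨contDiff_infty.mpr fun m => (h m).choose_spec.1, fun m => ?_⟩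
    obtain ⟨n, -, A, hA⟩ := h m
    refine ⟨2 * n, A, fun x => ?_⟩
    have hx := hA ⟨(x, Fin.last m), rfl⟩
    simp only [weighted, Fin.val_last] at hx
    have hA0 : 0 ≤ A := le_trans (by positivity) hx
    rw [inv_mul_le_iff₀ (by positivity)] at hx
    rw [norm_iteratedFDeriv_eq_norm_iteratedDeriv, pow_mul, mul_comm]
    refine hx.trans ?_
    gcongr
    rw [Real.norm_eq_abs]
    nlinarith [abs_nonneg x]
  · intro h m
    obtain ⟨k, C, hC, hk⟩ := h.norm_iteratedFDeriv_le_uniform m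
    refine ⟨k, h.1.of_le (by exact_mod_cast le_top), C * 2 ^ k, ?_⟩
    rintro _ ⟨⟨x, j⟩, rfl⟩
    have hx := hk j (Nat.lt_succ_iff.mp j.2) x
    rw [norm_iteratedFDeriv_eq_norm_iteratedDeriv, Real.norm_eq_abs] at hx
    simp only [weighted]
    rw [inv_mul_le_iff₀ (by positivity)]
    refine hx.trans ?_
    have h2 : (1 + |x|) ^ k ≤ (2 * (1 + |x| ^ 2)) ^ k := by
      gcongr
      nlinarith [sq_nonneg (|x| - 1), abs_nonneg x]
    calc C * (1 + |x|) ^ k ≤ C * (2 * (1 + |x| ^ 2)) ^ k := by gcongr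
      _ = _ := by rw [mul_pow]; ring

/-- The composition operator `C_ψ : 𝒪_M(ℝ) → 𝒪_M(ℝ)`, `f ↦ f ∘ ψ`, for a real-valued symbol
`ψ ∈ 𝒪_M(ℝ)`. -/
def compOp (𝕜 : Type*) [RCLike 𝕜] (ψ : ℝ → ℝ) (hψ : ψ ∈ multiplierSubmodule ℝ) :
    OM 𝕜 →ₗ[𝕜] OM 𝕜 where
  toFun f := ⟨f.1 ∘ ψ, mem_multiplierSubmodule_iff_hasTemperateGrowth.mpr
    ((mem_multiplierSubmodule_iff_hasTemperateGrowth.mp f.2).comp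
      (mem_multiplierSubmodule_iff_hasTemperateGrowth.mp hψ))⟩
  map_add' _ _ := rfl
  map_smul' _ _ := rfl

/-- A self-map `T` of a topological space is (topologically) mixing if for all non-empty open
sets `U`, `V` one has `Tⁿ(U) ∩ V ≠ ∅` for all sufficiently large `n`. -/
def IsMixing {X : Type*} [TopologicalSpace X] (T : X → X) : Prop :=
  ∀ U V : Set X, IsOpen U → U.Nonempty → IsOpen V → V.Nonempty →
    ∃ N : ℕ, ∀ n ≥ N, (T^[n] '' U ∩ V).Nonempty

/-- The map `ψ_{-n} : ψ_n(ℝ) → ℝ`, inverse to the `n`-th iterate `ψ_n` of an injective `ψ`;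
only its values on `ψ_n(ℝ)` are meaningful. -/
def negIterate (ψ : ℝ → ℝ) (n : ℕ) : ℝ → ℝ := Function.invFun ψ^[n]

/-- For every `k ≥ 1` and every Schwartz function `v`, the supremum of `|v(x) (ψ_{-n})⁽ᵏ⁾(x)|`
over all `x` in the image under `ψ_n` of the closed interval with end points `a` and `ψ(a)`
tends to `0` as `n → ∞`. The supremum is taken in `[0, ∞]`, and the derivatives are those of a
function on the domain `ψ_n(ℝ)`. -/
def InverseIteratesDecay (𝕜 : Type*) [RCLike 𝕜] (ψ : ℝ → ℝ) (a : ℝ) : Prop :=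
  ∀ k : ℕ, 1 ≤ k → ∀ v : 𝓢(ℝ, 𝕜),
    Tendsto (fun n : ℕ => ⨆ x ∈ ψ^[n] '' Set.Icc (min a (ψ a)) (max a (ψ a)),
      ‖v x * ((iteratedDerivWithin k (negIterate ψ n) (Set.range ψ^[n]) x : ℝ) : 𝕜)‖ₑ) atTop (𝓝 0)

end MultiplierSpace

end

/-! If `ψ` is injective without fixed points, it is increasing and moves all points in the same
direction. If moreover it omits a value, its iterates escape to infinity uniformly on the line
(`eventually_le_abs_iterate`).

Because of this escape, decay against all Schwartz weights is the same as `PolynomialGrowth`: for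
each order `k`, a single power of `1 + |x|²` bounds `(ψ_{-n})⁽ᵏ⁾` along the orbit for all large `n`
(`inverseIteratesDecay_iff`). If no power worked, a Schwartz function could be built that is too
large at the violating points (`exists_schwartz_slow_decay`).

Mixing implies growth: it yields `g = f ∘ ψ_n` with `f` small against a Schwartz weight and `g`
close to the identity on `K`. Then `f = g ∘ ψ_{-n}` on the range of `ψ_n`, so `(ψ_{-n})' = f' / (g'
∘ ψ_{-n})` with `g'` near 1, and induction on the order bounds all derivatives
(`IsMixing.polynomialGrowth`).

Growth implies mixing: the interval between `a` and `ψ(a)` is a fundamental domain, so growth passes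
from it to every compact set (`PolynomialGrowth.of_uIcc`). For `f`, `g` of compact support, `g ∘
ψ_{-n}` extended by zero tends to 0, and `f` plus this extension is sent to `g` by `C_ψⁿ` for large
`n` (`isMixing_of_polynomialGrowth`).

Only two facts about the topology enter: rapidly decaying weights give continuous seminorms, and
convergence in the norms of steps implies convergence in `𝒪_M(ℝ)`. -/

noncomputable section

namespace MultiplierSpace

/-! ### Bounds for derivatives of composites and products. -/

section DerivativeBounds

variable {F : Type*} [NormedAddCommGroup F] [NormedSpace ℝ F]

/-- A pointwise form of `norm_iteratedFDeriv_comp_le` for functions of one variable. -/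
lemma norm_iteratedDeriv_comp_le {g : ℝ → F} {f : ℝ → ℝ} {n : ℕ} {x : ℝ}
    (hg : ContDiffAt ℝ n g (f x)) (hf : ContDiffAt ℝ n f x) {C D : ℝ}
    (hC : ∀ i ≤ n, ‖iteratedDeriv i g (f x)‖ ≤ C)
    (hD : ∀ i, 1 ≤ i → i ≤ n → ‖iteratedDeriv i f x‖ ≤ D ^ i) :
    ‖iteratedDeriv n (g ∘ f) x‖ ≤ n.factorial * C * D ^ n := by
  obtain ⟨t₀, ht₀, hgt₀⟩ := hg.contDiffOn le_rfl (by simp)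
  obtain ⟨t, htt, hto, hxt⟩ := mem_nhds_iff.mp ht₀
  obtain ⟨s₀, hs₀, hfs₀⟩ := hf.contDiffOn le_rfl (by simp)
  obtain ⟨s, hss, hso, hxs⟩ := mem_nhds_iff.mp
    (inter_mem hs₀ (hf.continuousAt (hto.mem_nhds hxt)))
  have hfx : ∀ i, ‖iteratedFDerivWithin ℝ i f s x‖ = ‖iteratedDeriv i f x‖ := fun i => by
    rw [iteratedFDerivWithin_of_isOpen i hso hxs, norm_iteratedFDeriv_eq_norm_iteratedDeriv]
  have hgx : ∀ i, ‖iteratedFDerivWithin ℝ i g t (f x)‖ = ‖iteratedDeriv i g (f x)‖ := fun i => by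
    rw [iteratedFDerivWithin_of_isOpen i hto hxt, norm_iteratedFDeriv_eq_norm_iteratedDeriv]
  rw [← norm_iteratedFDeriv_eq_norm_iteratedDeriv, ← iteratedFDerivWithin_of_isOpen n hso hxs]
  exact norm_iteratedFDerivWithin_comp_le (N := n) (hgt₀.mono htt)
    (hfs₀.mono fun y hy => (hss hy).1) le_rfl hto.uniqueDiffOn hso.uniqueDiffOn
    (fun y hy => (hss hy).2) hxs (fun i hi => (hgx i).trans_le (hC i hi))
    (fun i h1 hi => (hfx i).trans_le (hD i h1 hi))

lemma norm_iteratedDeriv_mul_le_of_le {A : Type*} [NormedRing A] [NormedAlgebra ℝ A]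
    {f g : ℝ → A} {n : ℕ} {x : ℝ} (hf : ContDiffAt ℝ n f x) (hg : ContDiffAt ℝ n g x) {B C : ℝ}
    (hB : ∀ i ≤ n, ‖iteratedDeriv i f x‖ ≤ B) (hC : ∀ i ≤ n, ‖iteratedDeriv i g x‖ ≤ C) :
    ‖iteratedDeriv n (f * g) x‖ ≤ 2 ^ n * (B * C) := by
  have hB0 : 0 ≤ B := (norm_nonneg _).trans (hB 0 (Nat.zero_le _))
  rw [iteratedDeriv_mul hf hg]
  have hsum : (2 : ℝ) ^ n * (B * C) = ∑ i ∈ Finset.range (n + 1), (n.choose i : ℝ) * (B * C) := by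
    rw [← Finset.sum_mul]
    congr 1
    exact_mod_cast (Nat.sum_range_choose n).symm
  rw [hsum]
  refine norm_sum_le_of_le _ fun i hi => ?_
  rw [← nsmul_eq_mul, smul_mul_assoc, ← Nat.cast_smul_eq_nsmul ℝ, norm_smul]
  simp only [Real.norm_natCast]
  gcongr
  refine (norm_mul_le _ _).trans ?_
  have h1 := hB i (Nat.lt_succ_iff.mp (Finset.mem_range.mp hi))
  have h2 := hC (n - i) (Nat.sub_le _ _)
  gcongr

lemma _root_.ContDiffAt.continuousAt_iteratedDeriv {f : ℝ → F} {x : ℝ} (hf : ContDiffAt ℝ ∞ f x)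
    (i : ℕ) : ContinuousAt (iteratedDeriv i f) x := by
  have h : ContDiffAt ℝ 0 (iteratedFDeriv ℝ i f) x :=
    hf.iteratedFDeriv_right (by simpa using by exact_mod_cast le_top)
  rw [iteratedDeriv_eq_equiv_comp]
  exact (LinearIsometryEquiv.continuous _).continuousAt.comp h.continuousAt

lemma exists_bound_iteratedDeriv_of_isCompact {f : ℝ → F} {K : Set ℝ} (hK : IsCompact K)
    (hf : ∀ x ∈ K, ContDiffAt ℝ ∞ f x) (n : ℕ) :
    ∃ C, 1 ≤ C ∧ ∀ i ≤ n, ∀ x ∈ K, ‖iteratedDeriv i f x‖ ≤ C := by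
  have h : ∀ i, ∃ C, ∀ x ∈ K, ‖iteratedDeriv i f x‖ ≤ C := fun i =>
    hK.exists_bound_of_continuousOn fun x hx =>
      ((hf x hx).continuousAt_iteratedDeriv i).continuousWithinAt
  choose C hC using h
  refine ⟨1 + ∑ i ∈ Finset.range (n + 1), |C i|, ?_, fun i hi x hx => ?_⟩
  · exact le_add_of_nonneg_right (Finset.sum_nonneg fun _ _ => abs_nonneg _)
  · have := Finset.single_le_sum (f := fun i => |C i|) (fun _ _ => abs_nonneg _)
      (Finset.mem_range.mpr (Nat.lt_succ_iff.mpr hi))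
    linarith [hC i x hx, le_abs_self (C i)]

end DerivativeBounds

/-! ### Neighbourhoods and convergence in `𝒪_M(ℝ)`. -/

section Topology

variable {𝕜 : Type*} [RCLike 𝕜]

/-- A weight that decays faster than any power of `x`. -/
def RapidDecay (w : ℝ → ℝ) : Prop :=
  ∀ n : ℕ, ∃ C, ∀ x, |w x| * (1 + |x| ^ 2) ^ n ≤ C

lemma RapidDecay.mul_iteratedDeriv_le {w : ℝ → ℝ} {m n : ℕ} {f : ℝ → 𝕜} {A C : ℝ}
    (hC : ∀ x, |w x| * (1 + |x| ^ 2) ^ n ≤ C) (hA : ∀ p, weighted m n f p ≤ A)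
    (p : ℝ × Fin (m + 1)) : |w p.1| * ‖iteratedDeriv p.2 f p.1‖ ≤ C * A := by
  have h := hA p
  have h0 : 0 ≤ A := (weighted_nonneg _ _ _ _).trans h
  rw [weighted, inv_mul_le_iff₀ (by positivity)] at h
  calc |w p.1| * ‖iteratedDeriv p.2 f p.1‖ ≤ |w p.1| * ((1 + |p.1| ^ 2) ^ n * A) := by gcongr
    _ = |w p.1| * (1 + |p.1| ^ 2) ^ n * A := by ring
    _ ≤ C * A := by gcongr; exact hC _

lemma RapidDecay.bddAbove {w : ℝ → ℝ} (hw : RapidDecay w) {m : ℕ} (f : Lim 𝕜 m) :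
    BddAbove (Set.range fun p : ℝ × Fin (m + 1) => |w p.1| * ‖iteratedDeriv p.2 f.1 p.1‖) := by
  obtain ⟨n, -, A, hA⟩ := f.2
  obtain ⟨C, hC⟩ := hw n
  refine ⟨C * A, ?_⟩
  rintro _ ⟨p, rfl⟩
  exact RapidDecay.mul_iteratedDeriv_le hC (fun p => hA ⟨p, rfl⟩) p

lemma Lim.contDiff {m : ℕ} (f : Lim 𝕜 m) : ContDiff ℝ m f.1 := f.2.choose_spec.1

/-- The seminorm `sup {|w(x) f⁽ʲ⁾(x)| : x ∈ ℝ, 0 ≤ j ≤ m}` on `𝒪ᵐ(ℝ)`. -/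
def weightSeminorm {w : ℝ → ℝ} (hw : RapidDecay w) (m : ℕ) : Seminorm 𝕜 (Lim 𝕜 m) :=
  Seminorm.of (fun f => ⨆ p : ℝ × Fin (m + 1), |w p.1| * ‖iteratedDeriv p.2 f.1 p.1‖)
    (fun f g => by
      refine ciSup_le fun p => ?_
      refine le_trans ?_ (add_le_add (le_ciSup (hw.bddAbove f) p) (le_ciSup (hw.bddAbove g) p))
      change |w p.1| * ‖iteratedDeriv p.2 (f.1 + g.1) p.1‖ ≤ _
      rw [iteratedDeriv_add (contDiffAt_of_fin f.contDiff _ _)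
        (contDiffAt_of_fin g.contDiff _ _), ← mul_add]
      gcongr
      exact norm_add_le _ _)
    (fun c f => by
      rw [Real.mul_iSup_of_nonneg (norm_nonneg _)]
      refine iSup_congr fun p => ?_
      change |w p.1| * ‖iteratedDeriv p.2 (c • f.1) p.1‖ = _
      rw [iteratedDeriv_const_smul_field, norm_smul]
      ring)

lemma le_weightSeminorm {w : ℝ → ℝ} (hw : RapidDecay w) {m : ℕ} (f : Lim 𝕜 m) {j : ℕ}
    (hj : j ≤ m) (x : ℝ) : |w x| * ‖iteratedDeriv j f.1 x‖ ≤ weightSeminorm hw m f :=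
  le_ciSup (hw.bddAbove f) (x, (⟨j, Nat.lt_succ_iff.mpr hj⟩ : Fin (m + 1)))

lemma weightSeminorm_stepInclusion_le {w : ℝ → ℝ} (hw : RapidDecay w) (m n : ℕ) :
    ∃ C, ∀ f : Step 𝕜 m n, weightSeminorm hw m (stepInclusion 𝕜 m n f) ≤ C * ‖f‖ := by
  obtain ⟨C, hC⟩ := hw n
  exact ⟨C, fun f => ciSup_le fun p =>
    RapidDecay.mul_iteratedDeriv_le hC (fun p => le_ciSup f.2.2 p) p⟩

instance (m : ℕ) : IsScalarTower ℝ 𝕜 (Lim 𝕜 m) :=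
  inferInstanceAs (IsScalarTower ℝ 𝕜 ↥(limSubmodule 𝕜 m))

/-- The seminorm is bounded by a multiple of the norm on every step, so the topology it generates is
one of those competing in the infimum that defines the inductive limit; the latter is therefore
finer. -/
lemma isOpen_weightSeminorm_ball {w : ℝ → ℝ} (hw : RapidDecay w) {m : ℕ} (h : Lim 𝕜 m) :
    IsOpen {f : Lim 𝕜 m | weightSeminorm hw m (f - h) < 1} := by
  let p : SeminormFamily 𝕜 (Lim 𝕜 m) Unit := fun _ => weightSeminorm hw m
  let t : TopologicalSpace (Lim 𝕜 m) := p.moduleFilterBasis.topology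
  have hp : @WithSeminorms 𝕜 (Lim 𝕜 m) Unit _ _ _ p t := @WithSeminorms.mk _ _ _ _ _ _ p t rfl
  have hle : instTopologicalSpaceLim 𝕜 m ≤ t := by
    unfold instTopologicalSpaceLim
    refine sInf_le ?_
    refine ⟨@WithSeminorms.topologicalAddGroup _ _ _ _ _ _ t _ hp,
      @WithSeminorms.continuousSMul _ _ _ _ _ _ t _ hp,
      @WithSeminorms.toLocallyConvexSpace _ _ _ _ _ _ _ _ _ t _ hp, fun n => ?_⟩
    rw [@continuous_iff_continuousAt _ _ _ t]
    intro f
    refine (@WithSeminorms.tendsto_nhds _ _ _ _ _ _ _ t _ hp _ _ _).mpr fun _ ε hε => ?_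
    obtain ⟨C, hC⟩ := weightSeminorm_stepInclusion_le (𝕜 := 𝕜) hw m n
    have hlim : Tendsto (fun g : Step 𝕜 m n => C * ‖g - f‖) (𝓝 f) (𝓝 0) := by
      have : Tendsto (fun g : Step 𝕜 m n => C * ‖g - f‖) (𝓝 f) (𝓝 (C * ‖f - f‖)) :=
        Continuous.tendsto (by fun_prop) f
      simpa using this
    filter_upwards [hlim.eventually_lt_const hε] with g hg
    exact (hC (g - f)).trans_lt hg
  refine hle _ ?_
  refine (@WithSeminorms.isOpen_iff_mem_balls _ _ _ _ _ _ t _ hp _).mpr fun f hf => ?_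
  refine ⟨{()}, 1 - weightSeminorm hw m (f - h), sub_pos.mpr hf, fun g hg => ?_⟩
  rw [Finset.sup_singleton, Seminorm.mem_ball] at hg
  have := map_add_le_add (weightSeminorm hw m) (g - f) (f - h)
  rw [sub_add_sub_cancel] at this
  have hg' : weightSeminorm hw m (g - f) < 1 - weightSeminorm hw m (f - h) := hg
  change weightSeminorm hw m (g - h) < 1
  linarith

lemma OM.contDiff (f : OM 𝕜) : ContDiff ℝ ∞ f.1 :=
  (mem_multiplierSubmodule_iff_hasTemperateGrowth.mp f.2).1

/-- Every rapidly decaying weight defines neighbourhoods in `𝒪_M(ℝ)`. -/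
lemma exists_isOpen_weight {w : ℝ → ℝ} (hw : RapidDecay w) (m : ℕ) (h : OM 𝕜) :
    ∃ U : Set (OM 𝕜), IsOpen U ∧ h ∈ U ∧ ∀ f ∈ U, ∀ j ≤ m, ∀ x,
      |w x| * ‖iteratedDeriv j f.1 x - iteratedDeriv j h.1 x‖ ≤ 1 := by
  refine ⟨limInclusion 𝕜 m ⁻¹' {f | weightSeminorm hw m (f - limInclusion 𝕜 m h) < 1},
    ?_, ?_, fun f hf j hj x => ?_⟩
  · have hc : Continuous (limInclusion 𝕜 m) := continuous_iInf_dom continuous_induced_dom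
    exact (isOpen_weightSeminorm_ball hw _).preimage hc
  · simp
  · have h1 := (le_weightSeminorm hw (limInclusion 𝕜 m f - limInclusion 𝕜 m h) hj x).trans
      (le_of_lt hf)
    change |w x| * ‖iteratedDeriv j (f.1 - h.1) x‖ ≤ 1 at h1
    rwa [iteratedDeriv_sub (f.contDiff.of_le (by exact_mod_cast le_top)).contDiffAt
      (h.contDiff.of_le (by exact_mod_cast le_top)).contDiffAt] at h1

lemma continuous_stepInclusion (m n : ℕ) : Continuous (stepInclusion 𝕜 m n) :=
  continuous_sInf_rng.mpr fun _ ht => ht.2.2.2 n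

/-- A sufficient condition for convergence in `𝒪_M(ℝ)`. -/
lemma tendsto_of_weighted {ι : Type*} {l : Filter ι} {u : ι → OM 𝕜} {f : OM 𝕜}
    (h : ∀ m, ∃ n, ∀ ε > 0, ∀ᶠ i in l, ∀ p, weighted m n ((u i).1 - f.1) p ≤ ε) :
    Tendsto u l (𝓝 f) := by
  have key : ∀ m, Tendsto (fun i => limInclusion 𝕜 m (u i)) l (𝓝 (limInclusion 𝕜 m f)) := by
    intro m
    obtain ⟨n, hn⟩ := h m
    obtain ⟨n', hf, A, hA⟩ := mem_multiplierSubmodule.mp f.2 m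
    have hsm : ∀ g : OM 𝕜, ContDiff ℝ m g.1 := fun g => g.contDiff.of_le (by exact_mod_cast le_top)
    -- Eventually `u i` differs from `f` by an element of norm at most 1 in step `n`, so both lie in
    -- the common step `max n n'`, and convergence takes place in one normed space.
    have hmem : ∀ i, (∀ p, weighted m n ((u i).1 - f.1) p ≤ 1) →
        (u i).1 ∈ stepSubmodule 𝕜 m (max n n') := by
      intro i hi
      refine ⟨hsm _, 1 + A, ?_⟩
      rintro _ ⟨p, rfl⟩
      have h1 := weighted_add_le (max n n') ((hsm (u i)).sub (hsm f)) (hsm f) p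
      rw [show (fun x => (u i).1 x - f.1 x) + f.1 = (u i).1 from funext fun x => by simp] at h1
      refine h1.trans (add_le_add ?_ ?_)
      · exact (weighted_anti (le_max_left _ _) _ p).trans (hi p)
      · exact (weighted_anti (le_max_right _ _) _ p).trans (hA ⟨p, rfl⟩)
    have hfmem : f.1 ∈ stepSubmodule 𝕜 m (max n n') := by
      refine ⟨hf, A, ?_⟩
      rintro _ ⟨p, rfl⟩
      exact (weighted_anti (le_max_right _ _) _ p).trans (hA ⟨p, rfl⟩)
    let f' : Step 𝕜 m (max n n') := ⟨f.1, hfmem⟩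
    intro O hO
    have hO' : stepInclusion 𝕜 m (max n n') ⁻¹' O ∈ 𝓝 f' :=
      (continuous_stepInclusion m (max n n')).continuousAt hO
    obtain ⟨ε, hε, hball⟩ := Metric.mem_nhds_iff.mp hO'
    rw [mem_map]
    filter_upwards [hn 1 one_pos, hn (ε / 2) (half_pos hε)] with i h1 h2
    let g : Step 𝕜 m (max n n') := ⟨(u i).1, hmem i h1⟩
    have hg : g ∈ Metric.ball f' ε := by
      rw [mem_ball_iff_norm]
      refine lt_of_le_of_lt (ciSup_le fun p => ?_) (half_lt_self hε)
      exact (weighted_anti (le_max_left _ _) _ p).trans (h2 p)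
    exact hball hg
  have hnhds : 𝓝 f = ⨅ m, comap (limInclusion 𝕜 m) (𝓝 (limInclusion 𝕜 m f)) := by
    simp_rw [← nhds_induced]
    exact nhds_iInf
  rw [hnhds, tendsto_iInf]
  exact fun m => tendsto_comap_iff.mpr (key m)

end Topology

/-! ### Schwartz functions as test weights for polynomial growth. -/

section SchwartzWeights

variable {𝕜 : Type*} [RCLike 𝕜]

/-- After a shift by `l`, `l` of the factors absorb the numerator; each of the remaining `N` factors
is at least 2, which leaves a geometric series. -/
lemma summable_inv_pow_mul_pow {x : ℕ → ℝ} (hx : ∀ N, 1 ≤ |x N|) (l : ℕ) :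
    Summable fun N => ((1 + |x N| ^ 2) ^ N)⁻¹ * (1 + |x N|) ^ l := by
  rw [← summable_nat_add_iff l]
  refine Summable.of_nonneg_of_le (fun N => by positivity) (fun N => ?_)
    ((summable_geometric_of_lt_one (r := (1 / 2 : ℝ)) (by norm_num) (by norm_num)).mul_left (2 ^ l))
  have h1 := hx (N + l)
  set a := |x (N + l)|
  have h2 : 1 + a ≤ 2 * (1 + a ^ 2) := by nlinarith
  have h3 : (2 : ℝ) ≤ 1 + a ^ 2 := by nlinarith
  rw [inv_mul_le_iff₀ (by positivity)]
  calc (1 + a) ^ l ≤ (2 * (1 + a ^ 2)) ^ l := by gcongr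
    _ = (1 + a ^ 2) ^ l * (2 ^ l * (2 ^ N * (1 / 2) ^ N)) := by
      rw [← mul_pow 2 (1 / 2 : ℝ) N, mul_pow 2 (1 + a ^ 2) l]; norm_num; ring
    _ ≤ (1 + a ^ 2) ^ l * (2 ^ l * ((1 + a ^ 2) ^ N * (1 / 2) ^ N)) := by gcongr
    _ = (1 + a ^ 2) ^ (N + l) * (2 ^ l * (1 / 2) ^ N) := by ring

/-- A Schwartz function that decays slowly along a given sequence. -/
lemma exists_schwartz_slow_decay {x : ℕ → ℝ} (hx : ∀ N, 1 ≤ |x N|) :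
    ∃ v : 𝓢(ℝ, 𝕜), ∀ N, ((1 + |x N| ^ 2) ^ N)⁻¹ ≤ ‖v (x N)‖ := by
  let b : ContDiffBump (0 : ℝ) := ⟨1, 2, one_pos, by norm_num⟩
  let B : 𝓢(ℝ, ℝ) := b.hasCompactSupport.toSchwartzMap b.contDiff
  have hB : ∀ y, B y = b y := fun y => rfl
  let c : ℕ → ℝ := fun N => ((1 + |x N| ^ 2) ^ N)⁻¹
  have hc : ∀ N, 0 < c N := fun N => by positivity
  -- Bumps of height `c N` centred at `x N`. All terms are nonnegative, so the sum is at least `c N`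
  -- at `x N`, even if supports overlap.
  let f : ℕ → ℝ → ℝ := fun N y => c N * B (y - x N)
  have hM : ∀ k l, ∃ M, ∀ y, (1 + ‖y‖) ^ l * ‖iteratedFDeriv ℝ k B y‖ ≤ M := fun k l =>
    ⟨_, fun y => SchwartzMap.one_add_le_sup_seminorm_apply (𝕜 := ℝ) (m := (l, k)) le_rfl le_rfl B y⟩
  choose M hM using hM
  have hf : ∀ N, ContDiff ℝ ∞ (f N) := fun N =>
    contDiff_const.mul ((B.smooth ⊤).comp (contDiff_id.sub contDiff_const))
  have hbound : ∀ k l N y, (1 + ‖y‖) ^ l * ‖iteratedFDeriv ℝ k (f N) y‖ ≤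
      M k l * (c N * (1 + |x N|) ^ l) := by
    intro k l N y
    have h1 : iteratedFDeriv ℝ k (f N) y = c N • iteratedFDeriv ℝ k B (y - x N) := by
      rw [← iteratedFDeriv_comp_sub]
      exact iteratedFDeriv_const_smul_apply (a := c N)
        (((B.smooth k).comp (contDiff_id.sub contDiff_const)).contDiffAt)
    rw [h1, norm_smul, Real.norm_of_nonneg (hc N).le]
    -- This moves the polynomial weight from `y` to the centre `x N`, where the super-polynomially
    -- small `c N` controls it.
    have h2 : 1 + ‖y‖ ≤ (1 + ‖y - x N‖) * (1 + |x N|) := by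
      have := norm_add_le (y - x N) (x N)
      rw [sub_add_cancel, Real.norm_eq_abs (x N)] at this
      nlinarith [norm_nonneg (y - x N), abs_nonneg (x N)]
    calc (1 + ‖y‖) ^ l * (c N * ‖iteratedFDeriv ℝ k B (y - x N)‖)
        ≤ ((1 + ‖y - x N‖) * (1 + |x N|)) ^ l * (c N * ‖iteratedFDeriv ℝ k B (y - x N)‖) := by
          have := (hc N).le
          gcongr
      _ = (1 + ‖y - x N‖) ^ l * ‖iteratedFDeriv ℝ k B (y - x N)‖ * (c N * (1 + |x N|) ^ l) := by
          rw [mul_pow]; ring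
      _ ≤ _ := by
          have := (hc N).le
          gcongr
          exact hM k l _
  have hsum : ∀ k l, Summable fun N => M k l * (c N * (1 + |x N|) ^ l) := fun k l =>
    (summable_inv_pow_mul_pow hx l).mul_left _
  have hb0 : ∀ (k : ℕ) (N : ℕ) (y : ℝ), ‖iteratedFDeriv ℝ k (f N) y‖ ≤
      M k 0 * (c N * (1 + |x N|) ^ 0) := fun k N y => by simpa using hbound k 0 N y
  have hsmooth : ContDiff ℝ ∞ fun y => ∑' N, f N y :=
    contDiff_tsum (N := ⊤) (v := fun k N => M k 0 * (c N * (1 + |x N|) ^ 0)) hf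
      (fun k _ => hsum k 0) (fun k N y _ => hb0 k N y)
  let v : 𝓢(ℝ, ℝ) :=
    { toFun := fun y => ∑' N, f N y
      smooth' := hsmooth
      decay' := by
        intro l k
        refine ⟨∑' N, M k l * (c N * (1 + |x N|) ^ l), fun y => ?_⟩
        rw [iteratedFDeriv_tsum_apply (N := ⊤) (v := fun k N => M k 0 * (c N * (1 + |x N|) ^ 0)) hf
          (fun k _ => hsum k 0) (fun k N y _ => hb0 k N y) le_top]
        have h1 : ‖∑' N, iteratedFDeriv ℝ k (f N) y‖ ≤ ∑' N, ‖iteratedFDeriv ℝ k (f N) y‖ :=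
          norm_tsum_le_tsum_norm (Summable.of_nonneg_of_le (fun _ => norm_nonneg _)
            (fun N => hb0 k N y) (hsum k 0))
        calc ‖y‖ ^ l * ‖∑' N, iteratedFDeriv ℝ k (f N) y‖
            ≤ (1 + ‖y‖) ^ l * ∑' N, ‖iteratedFDeriv ℝ k (f N) y‖ := by
              gcongr
              exact le_add_of_nonneg_left zero_le_one
          _ = ∑' N, (1 + ‖y‖) ^ l * ‖iteratedFDeriv ℝ k (f N) y‖ := tsum_mul_left.symm
          _ ≤ _ := Summable.tsum_le_tsum (fun N => hbound k l N y)
              (Summable.of_nonneg_of_le (fun _ => by positivity) (fun N => hbound k l N y)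
                (hsum k l)) (hsum k l) }
  refine ⟨SchwartzMap.postcompCLM (RCLike.ofRealCLM (K := 𝕜)) v, fun N => ?_⟩
  have hnn : ∀ K, 0 ≤ f K (x N) := fun K => mul_nonneg (hc K).le b.nonneg
  have hsN : Summable fun K => f K (x N) :=
    Summable.of_nonneg_of_le hnn (fun K => by
      have := hb0 0 K (x N)
      rw [norm_iteratedFDeriv_zero] at this
      exact (le_abs_self _).trans this) (hsum 0 0)
  have hle : c N ≤ v (x N) := by
    have h1 : f N (x N) ≤ ∑' K, f K (x N) := hsN.le_tsum N fun K _ => hnn K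
    have h2 : f N (x N) = c N := by
      simp only [f, sub_self, hB]
      rw [b.one_of_mem_closedBall (by simp [b.rIn_pos.le]), mul_one]
    exact h2 ▸ h1
  rw [SchwartzMap.postcompCLM_apply]
  simp only [RCLike.ofRealCLM_apply, RCLike.norm_ofReal]
  exact hle.trans (le_abs_self _)

/-- A family that is bounded against every Schwartz weight on sets escaping to infinity is
polynomially bounded on these sets. -/
lemma exists_polynomial_bound {S : ℕ → Set ℝ} {F : ℕ → ℝ → ℝ}
    (hS : ∀ R : ℝ, ∀ᶠ n in atTop, ∀ x ∈ S n, R ≤ |x|)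
    (h : ∀ v : 𝓢(ℝ, 𝕜), ∀ᶠ n in atTop, ∀ x ∈ S n, ‖v x‖ * F n x ≤ 1) :
    ∃ N : ℕ, ∀ᶠ n in atTop, ∀ x ∈ S n, F n x ≤ (1 + |x| ^ 2) ^ N := by
  by_contra! hcon
  have hex : ∀ N : ℕ, ∃ n ≥ N, ∃ x ∈ S n, 1 ≤ |x| ∧ (1 + |x| ^ 2) ^ N < F n x := by
    intro N
    obtain ⟨n, ⟨x, hx, hlt⟩, hn, h1⟩ :=
      ((hcon N).and_eventually ((eventually_ge_atTop N).and (hS 1))).exists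
    exact ⟨n, hn, x, hx, h1 x hx, hlt⟩
  choose n hn x hx hx1 hlt using hex
  obtain ⟨v, hv⟩ := exists_schwartz_slow_decay (𝕜 := 𝕜) hx1
  -- The threshold for `v` also serves as the index of the violating point: `n N ≥ N` makes the
  -- bound applicable there.
  obtain ⟨N, hN⟩ := eventually_atTop.mp (h v)
  have h1 := hN (n N) (hn N) (x N) (hx N)
  have hpos : (0 : ℝ) < (1 + |x N| ^ 2) ^ N := by positivity
  have h2 : 1 < ‖v (x N)‖ * F (n N) (x N) := by
    calc (1 : ℝ) = ((1 + |x N| ^ 2) ^ N)⁻¹ * (1 + |x N| ^ 2) ^ N := by field_simp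
      _ < ((1 + |x N| ^ 2) ^ N)⁻¹ * F (n N) (x N) := by gcongr; exact hlt N
      _ ≤ _ := mul_le_mul_of_nonneg_right (hv N) (hpos.trans (hlt N)).le
  linarith

lemma rapidDecay_schwartz (v : 𝓢(ℝ, 𝕜)) : RapidDecay fun x => ‖v x‖ := by
  intro n
  obtain ⟨C, hC⟩ : ∃ C, ∀ x : ℝ, (1 + ‖x‖) ^ (2 * n) * ‖iteratedFDeriv ℝ 0 v x‖ ≤ C :=
    ⟨_, fun x => SchwartzMap.one_add_le_sup_seminorm_apply (𝕜 := ℝ) (m := (2 * n, 0))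
      le_rfl le_rfl v x⟩
  refine ⟨C, fun x => le_trans ?_ (hC x)⟩
  rw [norm_iteratedFDeriv_zero, abs_norm, mul_comm, pow_mul, Real.norm_eq_abs]
  gcongr
  nlinarith [abs_nonneg x]

end SchwartzWeights

/-! ### Dynamics of fixed-point-free injective maps of the line. -/

section Dynamics

variable {ψ : ℝ → ℝ}

/-- A decreasing `ψ` would have a fixed point, since `ψ(x) - x` changes sign between `0` and `ψ(0)`.
-/
lemma strictMono_of_injective_of_no_fixed (hc : Continuous ψ) (hinj : Function.Injective ψ)
    (hfix : ∀ x, ψ x ≠ x) : StrictMono ψ := by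
  refine (hc.strictMono_of_inj hinj).resolve_right fun hanti => ?_
  have hz : ∃ x, ψ x - x = 0 := by
    have hc' : Continuous fun x => ψ x - x := hc.sub continuous_id
    rcases lt_trichotomy (ψ 0) 0 with h | h | h
    · exact mem_range_of_exists_le_of_exists_ge hc' ⟨0, by linarith⟩
        ⟨ψ 0, by linarith [hanti h]⟩
    · exact absurd h (hfix 0)
    · exact mem_range_of_exists_le_of_exists_ge hc' ⟨ψ 0, by linarith [hanti h]⟩
        ⟨0, by linarith⟩
  obtain ⟨x, hx⟩ := hz
  exact hfix x (sub_eq_zero.mp hx)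

lemma forall_lt_or_forall_gt_of_no_fixed (hc : Continuous ψ) (hfix : ∀ x, ψ x ≠ x) :
    (∀ x, x < ψ x) ∨ ∀ x, ψ x < x := by
  by_contra! h
  obtain ⟨⟨x, hx⟩, y, hy⟩ := h
  obtain ⟨z, hz⟩ := mem_range_of_exists_le_of_exists_ge (f := fun x => ψ x - x) (c := 0)
    (hc.sub continuous_id) ⟨x, by linarith⟩ ⟨y, by linarith⟩
  exact hfix z (sub_eq_zero.mp hz)

/-- Conjugation by the reflection reduces the case `ψ(x) < x` to the case `x < ψ(x)`. -/
lemma iterate_neg_conj (ψ : ℝ → ℝ) (n : ℕ) (x : ℝ) :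
    (fun x => -ψ (-x))^[n] x = -ψ^[n] (-x) := by
  induction n generalizing x with
  | zero => simp
  | succ n ih => simp [ih]

/-- The orbit increases, and a finite limit would be a fixed point. -/
lemma tendsto_iterate_atTop (hc : Continuous ψ) (hlt : ∀ x, x < ψ x) (x : ℝ) :
    Tendsto (fun n => ψ^[n] x) atTop atTop := by
  have hm : Monotone fun n => ψ^[n] x := monotone_nat_of_le_succ fun n => by
    rw [Function.iterate_succ_apply']
    exact (hlt _).le
  refine (tendsto_atTop_of_monotone hm).resolve_right ?_
  rintro ⟨l, hl⟩
  exact (hlt l).ne' (isFixedPt_of_tendsto_iterate hl hc.continuousAt)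

/-- An omitted value `y` lies below the whole range because `y < ψ(y)`. One application of `ψ` thus
lifts every point above `y`, and from then on the orbit of `y` is a lower bound. -/
lemma eventually_le_iterate (hc : Continuous ψ) (hmono : Monotone ψ) (hlt : ∀ x, x < ψ x)
    (hns : ¬ Function.Surjective ψ) (R : ℝ) : ∀ᶠ n in atTop, ∀ x, R ≤ ψ^[n] x := by
  obtain ⟨y, hy⟩ := not_forall.mp hns
  have hy' : ∀ x, y ≤ ψ x := fun x => by
    by_contra! h
    exact hy (mem_range_of_exists_le_of_exists_ge hc ⟨x, h.le⟩ ⟨y, (hlt y).le⟩)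
  have h := (tendsto_iterate_atTop hc hlt y).eventually_ge_atTop R
  rw [← map_add_atTop_eq_nat 1, eventually_map]
  filter_upwards [h] with n hn x
  rw [Function.iterate_succ_apply]
  exact hn.trans (hmono.iterate n (hy' x))

/-- The iterates of a non-surjective injective map without fixed points escape to infinity
uniformly on the line. -/
lemma eventually_le_abs_iterate (hc : Continuous ψ) (hinj : Function.Injective ψ)
    (hfix : ∀ x, ψ x ≠ x) (hns : ¬ Function.Surjective ψ) (R : ℝ) :
    ∀ᶠ n in atTop, ∀ x, R ≤ |ψ^[n] x| := by
  have hmono := (strictMono_of_injective_of_no_fixed hc hinj hfix).monotone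
  rcases forall_lt_or_forall_gt_of_no_fixed hc hfix with h | h
  · filter_upwards [eventually_le_iterate hc hmono h hns R] with n hn x
    exact (hn x).trans (le_abs_self _)
  · have h' := eventually_le_iterate (ψ := fun x => -ψ (-x)) (by fun_prop)
      (fun x y hxy => neg_le_neg (hmono (neg_le_neg hxy))) (fun x => by linarith [h (-x)])
      (fun hs => hns fun y => by
        obtain ⟨x, hx⟩ := hs (-y)
        exact ⟨-x, neg_injective hx⟩) R
    filter_upwards [h'] with n hn x
    have := hn (-x)
    rw [iterate_neg_conj, neg_neg] at this
    exact this.trans (neg_le_abs _)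

/-- By the intermediate value theorem, `ψ_j` maps the fundamental interval onto a set covering
everything between `ψ_j(a)` and `ψ_{j+1}(a)`. -/
lemma exists_iterate_eq_of_mem_Icc (hc : Continuous ψ) (a : ℝ) (J : ℕ) {y : ℝ}
    (hy : y ∈ Set.Icc a (ψ^[J] a)) : ∃ j ≤ J, ∃ t ∈ Set.uIcc a (ψ a), y = ψ^[j] t := by
  induction J with
  | zero => exact ⟨0, le_rfl, a, Set.left_mem_uIcc, le_antisymm hy.2 hy.1⟩
  | succ J ih =>
    rcases le_total y (ψ^[J] a) with h | h
    · obtain ⟨j, hj, ht⟩ := ih ⟨hy.1, h⟩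
      exact ⟨j, hj.trans (Nat.le_succ J), ht⟩
    · have h2 := intermediate_value_uIcc (hc.iterate J).continuousOn (a := a) (b := ψ a)
        (Set.Icc_subset_uIcc ⟨h, by simpa using hy.2⟩)
      obtain ⟨t, ht, hty⟩ := h2
      exact ⟨J, Nat.le_succ J, t, ht, hty.symm⟩

lemma exists_iterate_cover_of_lt (hc : Continuous ψ) (hmono : Monotone ψ) (hlt : ∀ x, x < ψ x)
    (a : ℝ) {K : Set ℝ} (hK : IsCompact K) :
    ∃ J J' : ℕ, ∀ x ∈ K, ∃ j ≤ J', ∃ t ∈ Set.uIcc a (ψ a), ψ^[J] x = ψ^[j] t := by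
  obtain ⟨b, hb⟩ := hK.bddBelow
  obtain ⟨c, hc'⟩ := hK.bddAbove
  obtain ⟨J, hJ⟩ := ((tendsto_iterate_atTop hc hlt b).eventually_ge_atTop a).exists
  obtain ⟨J', hJ'⟩ := ((tendsto_iterate_atTop hc hlt a).eventually_ge_atTop (ψ^[J] c)).exists
  refine ⟨J, J', fun x hx => exists_iterate_eq_of_mem_Icc hc a J' ⟨?_, ?_⟩⟩
  · exact hJ.trans (hmono.iterate J (hb hx))
  · exact (hmono.iterate J (hc' hx)).trans hJ'

/-- The forward orbit of the interval between `a` and `ψ(a)` absorbs every compact set. -/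
lemma exists_iterate_cover (hc : Continuous ψ) (hinj : Function.Injective ψ)
    (hfix : ∀ x, ψ x ≠ x) (a : ℝ) {K : Set ℝ} (hK : IsCompact K) :
    ∃ J J' : ℕ, ∀ x ∈ K, ∃ j ≤ J', ∃ t ∈ Set.uIcc a (ψ a), ψ^[J] x = ψ^[j] t := by
  have hmono := (strictMono_of_injective_of_no_fixed hc hinj hfix).monotone
  rcases forall_lt_or_forall_gt_of_no_fixed hc hfix with h | h
  · exact exists_iterate_cover_of_lt hc hmono h a hK
  · obtain ⟨J, J', hJ⟩ := exists_iterate_cover_of_lt (ψ := fun x => -ψ (-x)) (by fun_prop)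
      (fun x y hxy => neg_le_neg (hmono (neg_le_neg hxy))) (fun x => by linarith [h (-x)])
      (-a) (hK.image continuous_neg)
    refine ⟨J, J', fun x hx => ?_⟩
    obtain ⟨j, hj, t, ht, hxt⟩ := hJ (-x) ⟨x, hx, rfl⟩
    refine ⟨j, hj, -t, ?_, ?_⟩
    · rw [neg_neg] at ht
      have := Set.mem_image_of_mem Neg.neg ht
      simpa [Set.image_neg_eq_neg] using this
    · rw [iterate_neg_conj, iterate_neg_conj, neg_neg] at hxt
      exact neg_injective hxt

end Dynamics

/-! ### Smoothness and polynomial growth of the inverse iterates. -/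

section InverseIterates

variable {ψ : ℝ → ℝ}

lemma contDiff_iterate (hψ : ContDiff ℝ ∞ ψ) (n : ℕ) : ContDiff ℝ ∞ ψ^[n] := by
  induction n with
  | zero => exact contDiff_id
  | succ n ih =>
    rw [Function.iterate_succ]
    exact ih.comp hψ

lemma deriv_iterate_ne_zero (hψ : Differentiable ℝ ψ) (hd : ∀ x, deriv ψ x ≠ 0) (n : ℕ) (x : ℝ) :
    deriv ψ^[n] x ≠ 0 := by
  induction n generalizing x with
  | zero => simp
  | succ n ih =>
    rw [Function.iterate_succ, deriv_comp x ((hψ.iterate n) _) (hψ x)]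
    exact mul_ne_zero (ih _) (hd x)

lemma isOpenMap_of_deriv_ne_zero {η : ℝ → ℝ} (hη : ContDiff ℝ ∞ η) (hd : ∀ x, deriv η x ≠ 0) :
    IsOpenMap η :=
  isOpenMap_of_hasStrictDerivAt (fun x => hη.hasStrictDerivAt (by simp)) hd

lemma contDiffAt_invFun {η : ℝ → ℝ} (hη : ContDiff ℝ ∞ η) (hinj : Function.Injective η)
    (hd : ∀ x, deriv η x ≠ 0) (x : ℝ) : ContDiffAt ℝ ∞ (Function.invFun η) (η x) := by
  have ho := isOpenMap_of_deriv_ne_zero hη hd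
  let e := (IsOpenEmbedding.of_continuous_injective_isOpenMap hη.continuous hinj
    ho).toOpenPartialHomeomorph η
  have he : ∀ y, e.symm (η y) = y := fun y => e.left_inv (Set.mem_univ y)
  have hx : ContDiffAt ℝ ∞ e.symm (η x) := by
    refine e.contDiffAt_symm_deriv (hd x) (e.map_source (Set.mem_univ x)) ?_ hη.contDiffAt
    rw [he]
    exact (hη.differentiable (by simp) x).hasDerivAt
  refine hx.congr_of_eventuallyEq ?_
  filter_upwards [ho.isOpen_range.mem_nhds (Set.mem_range_self x)]
  rintro _ ⟨y, rfl⟩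
  rw [he, Function.leftInverse_invFun hinj]

lemma negIterate_iterate (hinj : Function.Injective ψ) (n : ℕ) (x : ℝ) :
    negIterate ψ n (ψ^[n] x) = x :=
  Function.leftInverse_invFun (hinj.iterate n) x

lemma isOpen_range_iterate (hψ : ContDiff ℝ ∞ ψ) (hd : ∀ x, deriv ψ x ≠ 0) (n : ℕ) :
    IsOpen (Set.range ψ^[n]) :=
  (isOpenMap_of_deriv_ne_zero (contDiff_iterate hψ n)
    (deriv_iterate_ne_zero (hψ.differentiable (by simp)) hd n)).isOpen_range

lemma contDiffAt_negIterate (hψ : ContDiff ℝ ∞ ψ) (hinj : Function.Injective ψ)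
    (hd : ∀ x, deriv ψ x ≠ 0) (n : ℕ) (x : ℝ) : ContDiffAt ℝ ∞ (negIterate ψ n) (ψ^[n] x) :=
  contDiffAt_invFun (contDiff_iterate hψ n) (hinj.iterate n)
    (deriv_iterate_ne_zero (hψ.differentiable (by simp)) hd n) x

/-- The derivatives of the inverse iterates grow at most polynomially along the orbit of `K`. -/
def PolynomialGrowth (ψ : ℝ → ℝ) (K : Set ℝ) : Prop :=
  ∀ k : ℕ, 1 ≤ k → ∃ N : ℕ, ∀ᶠ n in atTop, ∀ x ∈ K,
    |iteratedDeriv k (negIterate ψ n) (ψ^[n] x)| ≤ (1 + |ψ^[n] x| ^ 2) ^ N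

/-- Polynomial bounds of finitely many derivatives can be taken with the same exponent. -/
lemma exists_uniform_growth {K : Set ℝ} {k : ℕ}
    (h : ∀ i, 1 ≤ i → i ≤ k → ∃ N : ℕ, ∀ᶠ n in atTop, ∀ x ∈ K,
      |iteratedDeriv i (negIterate ψ n) (ψ^[n] x)| ≤ (1 + |ψ^[n] x| ^ 2) ^ N) :
    ∃ N : ℕ, ∀ᶠ n in atTop, ∀ x ∈ K, ∀ i, 1 ≤ i → i ≤ k →
      |iteratedDeriv i (negIterate ψ n) (ψ^[n] x)| ≤ (1 + |ψ^[n] x| ^ 2) ^ N := by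
  choose! N hN using h
  refine ⟨∑ i ∈ Finset.range (k + 1), N i, ?_⟩
  have hall : ∀ᶠ n in atTop, ∀ i ∈ Finset.Icc 1 k, ∀ x ∈ K,
      |iteratedDeriv i (negIterate ψ n) (ψ^[n] x)| ≤ (1 + |ψ^[n] x| ^ 2) ^ N i :=
    (Finset.eventually_all _).mpr fun i hi =>
      hN i (Finset.mem_Icc.mp hi).1 (Finset.mem_Icc.mp hi).2
  filter_upwards [hall] with n hn x hx i h1 hi
  refine (hn i (Finset.mem_Icc.mpr ⟨h1, hi⟩) x hx).trans ?_
  refine pow_le_pow_right₀ (by nlinarith [sq_nonneg |ψ^[n] x|]) ?_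
  exact Finset.single_le_sum (f := N) (fun _ _ => Nat.zero_le _)
    (Finset.mem_range.mpr (Nat.lt_succ_iff.mpr hi))

/-- Constants can be absorbed into polynomial bounds along escaping orbits. -/
lemma eventually_const_mul_le (hesc : ∀ R : ℝ, ∀ᶠ n in atTop, ∀ x, R ≤ |ψ^[n] x|) (C : ℝ)
    (N : ℕ) : ∃ N' : ℕ, ∀ᶠ n in atTop, ∀ x,
      C * (1 + |ψ^[n] x| ^ 2) ^ N ≤ (1 + |ψ^[n] x| ^ 2) ^ N' := by
  obtain ⟨M, hM⟩ := pow_unbounded_of_one_lt C one_lt_two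
  refine ⟨M + N, ?_⟩
  filter_upwards [hesc 1] with n hn x
  rw [pow_add]
  gcongr
  refine hM.le.trans ?_
  gcongr
  nlinarith [hn x]

/-- Polynomial growth along the orbit of one fundamental interval implies polynomial growth along
the orbit of every compact set. -/
lemma PolynomialGrowth.of_uIcc (hψ : ContDiff ℝ ∞ ψ) (hinj : Function.Injective ψ)
    (hd : ∀ x, deriv ψ x ≠ 0) (hfix : ∀ x, ψ x ≠ x)
    (hesc : ∀ R : ℝ, ∀ᶠ n in atTop, ∀ x, R ≤ |ψ^[n] x|) {a : ℝ}
    (h : PolynomialGrowth ψ (Set.uIcc a (ψ a))) {K : Set ℝ} (hK : IsCompact K) :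
    PolynomialGrowth ψ K := by
  intro k _
  obtain ⟨J, J', hJ⟩ := exists_iterate_cover hψ.continuous hinj hfix a hK
  obtain ⟨N, hN⟩ := exists_uniform_growth (k := k) fun i h1 _ => h i h1
  have hθ : ∀ j t, ψ^[j] t ∈ Set.range ψ^[J] → ContDiffAt ℝ ∞ (negIterate ψ J ∘ ψ^[j]) t := by
    rintro j t ⟨s, hs⟩
    refine ContDiffAt.comp t ?_ (contDiff_iterate hψ j).contDiffAt
    rw [← hs]
    exact contDiffAt_negIterate hψ hinj hd J s
  -- The transition maps `ψ_{-J} ∘ ψ_j` do not depend on `n` and only `j ≤ J'` occur, so compactness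
  -- bounds their derivatives by constants.
  have hT : ∀ j, ∃ C, 1 ≤ C ∧ ∀ i ≤ k, ∀ t ∈ Set.uIcc a (ψ a) ∩ ψ^[j] ⁻¹' (ψ^[J] '' K),
      ‖iteratedDeriv i (negIterate ψ J ∘ ψ^[j]) t‖ ≤ C := fun j =>
    exists_bound_iteratedDeriv_of_isCompact
      (isCompact_uIcc.inter_right ((hK.image (contDiff_iterate hψ J).continuous).isClosed.preimage
        (contDiff_iterate hψ j).continuous))
      (fun t ht => hθ j t (Set.image_subset_range _ _ ht.2)) k
  choose C hC1 hC using hT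
  obtain ⟨N', hN'⟩ := eventually_const_mul_le hesc
    (k.factorial * ∑ j ∈ Finset.range (J' + 1), C j) (N * k)
  obtain ⟨n₀, hn₀⟩ := eventually_atTop.mp hN
  refine ⟨N', ?_⟩
  filter_upwards [hN', eventually_ge_atTop (n₀ + J)] with n hn hnJ x hx
  refine le_trans ?_ (hn x)
  obtain ⟨j, hj, t, ht, hxt⟩ := hJ x hx
  have hit : ∀ s t, ψ^[J] s = ψ^[j] t → ψ^[n - J + j] t = ψ^[n] s := fun s t hst => by
    rw [Function.iterate_add_apply, ← hst, ← Function.iterate_add_apply,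
      Nat.sub_add_cancel (by omega)]
  have hy := hit x t hxt
  have hcd := contDiffAt_negIterate hψ hinj hd (n - J + j) t
  -- From `ψ_J(x) = ψ_j(t)`, the inverse `ψ_{-n}` near `ψ_n(x)` is a transition map after
  -- `ψ_{-(n-J+j)}`, whose growth is known on the fundamental interval.
  have hloc : negIterate ψ n =ᶠ[𝓝 (ψ^[n - J + j] t)]
      (negIterate ψ J ∘ ψ^[j]) ∘ negIterate ψ (n - J + j) := by
    have hcont : ContinuousAt (ψ^[j] ∘ negIterate ψ (n - J + j)) (ψ^[n - J + j] t) :=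
      (contDiff_iterate hψ j).continuous.continuousAt.comp hcd.continuousAt
    have hmem : Set.range ψ^[J] ∈ 𝓝 ((ψ^[j] ∘ negIterate ψ (n - J + j)) (ψ^[n - J + j] t)) := by
      refine (isOpen_range_iterate hψ hd J).mem_nhds ⟨x, ?_⟩
      rw [Function.comp_apply, negIterate_iterate hinj, hxt]
    filter_upwards [hcont hmem, (isOpen_range_iterate hψ hd (n - J + j)).mem_nhds
      (Set.mem_range_self t)]
    rintro _ hs ⟨t', rfl⟩
    rw [Set.mem_preimage, Function.comp_apply, negIterate_iterate hinj] at hs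
    obtain ⟨s, hs⟩ := hs
    simp only [Function.comp_apply]
    rw [negIterate_iterate hinj, ← hs, negIterate_iterate hinj, hit s t' hs,
      negIterate_iterate hinj]
  rw [← hy, hloc.iteratedDeriv_eq, ← Real.norm_eq_abs]
  have hD1 : (1 : ℝ) ≤ (1 + |ψ^[n - J + j] t| ^ 2) ^ N :=
    one_le_pow₀ (by nlinarith [sq_nonneg |ψ^[n - J + j] t|])
  have hback := negIterate_iterate hinj (n - J + j) t
  have hb := norm_iteratedDeriv_comp_le (n := k) (g := negIterate ψ J ∘ ψ^[j])
    (f := negIterate ψ (n - J + j)) (x := ψ^[n - J + j] t) (C := C j)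
    (D := (1 + |ψ^[n - J + j] t| ^ 2) ^ N)
    (by rw [hback]; exact (hθ j t ⟨x, hxt⟩).of_le (by exact_mod_cast le_top))
    (hcd.of_le (by exact_mod_cast le_top))
    (fun i hi => by rw [hback]; exact hC j i hi t ⟨ht, x, hx, hxt⟩)
    (fun i h1 hi => (hn₀ _ (by omega) t ht i h1 hi).trans (le_self_pow₀ hD1 (by omega)))
  refine hb.trans ?_
  rw [← pow_mul]
  gcongr
  exact Finset.single_le_sum (f := C) (fun i _ => zero_le_one.trans (hC1 i))
    (Finset.mem_range.mpr (Nat.lt_succ_iff.mpr hj))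

variable {𝕜 : Type*} [RCLike 𝕜]

lemma enorm_mul_iteratedDerivWithin (hψ : ContDiff ℝ ∞ ψ) (hd : ∀ x, deriv ψ x ≠ 0)
    (v : ℝ → 𝕜) (k n : ℕ) (x : ℝ) :
    ‖v (ψ^[n] x) * ((iteratedDerivWithin k (negIterate ψ n) (Set.range ψ^[n]) (ψ^[n] x) : ℝ) : 𝕜)‖ₑ
      = ENNReal.ofReal (‖v (ψ^[n] x)‖ * |iteratedDeriv k (negIterate ψ n) (ψ^[n] x)|) := by
  rw [iteratedDerivWithin_of_isOpen (isOpen_range_iterate hψ hd n) (Set.mem_range_self x),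
    ← ofReal_norm, norm_mul, RCLike.norm_ofReal]

lemma inverseIteratesDecay_iff (hψ : ContDiff ℝ ∞ ψ)
    (hd : ∀ x, deriv ψ x ≠ 0) (hesc : ∀ R : ℝ, ∀ᶠ n in atTop, ∀ x, R ≤ |ψ^[n] x|) (a : ℝ) :
    InverseIteratesDecay 𝕜 ψ a ↔ PolynomialGrowth ψ (Set.uIcc a (ψ a)) := by
  have himage : ∀ (k n : ℕ) (v : 𝓢(ℝ, 𝕜)) (c : ENNReal),
      (⨆ x ∈ ψ^[n] '' Set.Icc (min a (ψ a)) (max a (ψ a)),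
        ‖v x * ((iteratedDerivWithin k (negIterate ψ n) (Set.range ψ^[n]) x : ℝ) : 𝕜)‖ₑ) ≤ c ↔
      ∀ x ∈ Set.uIcc a (ψ a), ENNReal.ofReal
        (‖v (ψ^[n] x)‖ * |iteratedDeriv k (negIterate ψ n) (ψ^[n] x)|) ≤ c := by
    intro k n v c
    rw [iSup₂_le_iff, Set.forall_mem_image]
    refine forall₂_congr fun x _ => ?_
    rw [enorm_mul_iteratedDerivWithin hψ hd]
  constructor
  · intro h k hk
    obtain ⟨N, hN⟩ := exists_polynomial_bound (𝕜 := 𝕜)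
      (S := fun n => ψ^[n] '' Set.uIcc a (ψ a))
      (F := fun n x => |iteratedDeriv k (negIterate ψ n) x|)
      (fun R => (hesc R).mono fun n hn => by
        rintro _ ⟨x, -, rfl⟩
        exact hn x)
      (fun v => by
        filter_upwards [ENNReal.tendsto_nhds_zero.mp (h k hk v) 1 one_pos] with n hn
        rintro _ ⟨x, hx, rfl⟩
        have := (himage k n v 1).mp hn x hx
        rwa [ENNReal.ofReal_le_one] at this)
    exact ⟨N, hN.mono fun n hn x hx => hn _ ⟨x, hx, rfl⟩⟩
  · intro h k hk v
    obtain ⟨N, hN⟩ := h k hk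
    -- The spare power turns boundedness into convergence to zero: `1 + |y|² ≥ C / δ` once the orbit
    -- is far out.
    obtain ⟨C, hC⟩ := rapidDecay_schwartz v (N + 1)
    have hC0 : 0 ≤ C := le_trans (by positivity) (hC 0)
    rw [ENNReal.tendsto_nhds_zero]
    intro ε hε
    obtain ⟨δ, hδ, hδε⟩ : ∃ δ : ℝ, 0 < δ ∧ ENNReal.ofReal δ ≤ ε := by
      obtain ⟨δ, h0, h1⟩ := ENNReal.lt_iff_exists_nnreal_btwn.mp hε
      exact ⟨δ, by exact_mod_cast h0, by simpa using h1.le⟩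
    filter_upwards [hN, hesc (C / δ), hesc 1] with n hn hR h1
    rw [himage]
    intro x hx
    refine (ENNReal.ofReal_le_ofReal ?_).trans hδε
    have hCx := hC (ψ^[n] x)
    rw [abs_norm, pow_succ] at hCx
    have hR' := hR x
    rw [div_le_iff₀ hδ] at hR'
    set y := ψ^[n] x
    have hy : C ≤ δ * (1 + |y| ^ 2) := by nlinarith [h1 x]
    have hpos : 0 < 1 + |y| ^ 2 := by positivity
    calc ‖v y‖ * |iteratedDeriv k (negIterate ψ n) y| ≤ ‖v y‖ * (1 + |y| ^ 2) ^ N := by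
          gcongr
          exact hn x hx
      _ ≤ δ := by
          refine le_of_mul_le_mul_right ?_ hpos
          calc _ = ‖v y‖ * ((1 + |y| ^ 2) ^ N * (1 + |y| ^ 2)) := by ring
            _ ≤ C := hCx
            _ ≤ _ := hy

end InverseIterates

/-! ### Necessary conditions for mixing. -/

section Mixing

variable {𝕜 : Type*} [RCLike 𝕜] {ψ : ℝ → ℝ}

lemma contDiff_of_mem (hψ : ψ ∈ multiplierSubmodule ℝ) : ContDiff ℝ ∞ ψ :=
  (mem_multiplierSubmodule_iff_hasTemperateGrowth.mp hψ).1

lemma compOp_iterate_apply (hψ : ψ ∈ multiplierSubmodule ℝ) (n : ℕ) (f : OM 𝕜) :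
    ((compOp 𝕜 ψ hψ)^[n] f).1 = f.1 ∘ ψ^[n] := by
  induction n with
  | zero => rfl
  | succ n ih =>
    rw [Function.iterate_succ_apply', Function.iterate_succ, ← Function.comp_assoc, ← ih]
    rfl

lemma rapidDecay_indicator {K : Set ℝ} (hK : Bornology.IsBounded K) (c : ℝ) :
    RapidDecay (K.indicator fun _ => c) := by
  intro n
  obtain ⟨R, hR⟩ := hK.exists_norm_le
  refine ⟨|c| * (1 + R ^ 2) ^ n, fun x => ?_⟩
  by_cases hx : x ∈ K
  · rw [Set.indicator_of_mem hx]
    have := hR x hx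
    rw [Real.norm_eq_abs] at this
    gcongr
  · rw [Set.indicator_of_notMem hx]
    simp only [abs_zero, zero_mul]
    positivity

/-- `Cᵐ`-neighbourhoods over a bounded set are neighbourhoods in `𝒪_M(ℝ)`. -/
lemma exists_isOpen_closeOn {K : Set ℝ} (hK : Bornology.IsBounded K) {ε : ℝ} (hε : 0 < ε) (m : ℕ)
    (h : OM 𝕜) : ∃ U : Set (OM 𝕜), IsOpen U ∧ h ∈ U ∧ ∀ f ∈ U, ∀ j ≤ m, ∀ x ∈ K,
      ‖iteratedDeriv j f.1 x - iteratedDeriv j h.1 x‖ ≤ ε := by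
  obtain ⟨U, hU, hhU, hf⟩ := exists_isOpen_weight (rapidDecay_indicator hK ε⁻¹) m h
  refine ⟨U, hU, hhU, fun f hfU j hj x hx => ?_⟩
  have := hf f hfU j hj x
  rwa [Set.indicator_of_mem hx, abs_of_pos (inv_pos.mpr hε), inv_mul_le_iff₀ hε, mul_one] at this

/-- The inclusion `ℝ → 𝕜` as an element of `𝒪_M(ℝ)`. -/
def coordinate (𝕜 : Type*) [RCLike 𝕜] : OM 𝕜 :=
  ⟨fun x => (x : 𝕜), mem_multiplierSubmodule_iff_hasTemperateGrowth.mpr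
    (Function.RCLike.hasTemperateGrowth_ofReal 𝕜)⟩

lemma IsMixing.exists_comp {hψ : ψ ∈ multiplierSubmodule ℝ} (hmix : IsMixing (compOp 𝕜 ψ hψ))
    {U V : Set (OM 𝕜)} (hU : IsOpen U) (hU' : U.Nonempty) (hV : IsOpen V) (hV' : V.Nonempty) :
    ∀ᶠ n in atTop, ∃ f ∈ U, ∃ g ∈ V, g.1 = f.1 ∘ ψ^[n] := by
  obtain ⟨N, hN⟩ := hmix U V hU hU' hV hV'
  filter_upwards [eventually_ge_atTop N] with n hn
  obtain ⟨_, ⟨f, hf, rfl⟩, hg⟩ := hN n hn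
  exact ⟨f, hf, _, hg, compOp_iterate_apply hψ n f⟩

/-- At a fixed point `f` and `f ∘ ψ_n` agree, so they cannot be close to 0 and to 1 respectively. -/
lemma IsMixing.no_fixed {hψ : ψ ∈ multiplierSubmodule ℝ} (hmix : IsMixing (compOp 𝕜 ψ hψ))
    (x : ℝ) : ψ x ≠ x := by
  intro hx
  let c : OM 𝕜 := ⟨fun _ => 1, mem_multiplierSubmodule_iff_hasTemperateGrowth.mpr
    (.const 1)⟩
  obtain ⟨U, hU, hU0, hUf⟩ := exists_isOpen_closeOn (𝕜 := 𝕜) (K := {x})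
    Bornology.isBounded_singleton (ε := 1 / 4) (by norm_num) 0 0
  obtain ⟨V, hV, hV0, hVg⟩ := exists_isOpen_closeOn (𝕜 := 𝕜) (K := {x})
    Bornology.isBounded_singleton (ε := 1 / 4) (by norm_num) 0 c
  obtain ⟨n, f, hf, g, hg, hgf⟩ := (hmix.exists_comp hU ⟨_, hU0⟩ hV ⟨_, hV0⟩).exists
  have h1 : ‖f.1 x - 0‖ ≤ 1 / 4 := hUf f hf 0 le_rfl x rfl
  have h2 : ‖g.1 x - 1‖ ≤ 1 / 4 := hVg g hg 0 le_rfl x rfl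
  rw [hgf, Function.comp_apply, Function.iterate_fixed hx] at h2
  have h3 := norm_sub_le (f.1 x - 0) (f.1 x - 1)
  rw [sub_sub_sub_cancel_left, sub_zero, norm_one] at h3
  linarith

lemma IsMixing.injective {hψ : ψ ∈ multiplierSubmodule ℝ} (hmix : IsMixing (compOp 𝕜 ψ hψ)) :
    Function.Injective ψ := by
  intro x y hxy
  by_contra hne
  have hpos : 0 < |x - y| := abs_pos.mpr (sub_ne_zero.mpr hne)
  obtain ⟨V, hV, hV0, hVg⟩ := exists_isOpen_closeOn (𝕜 := 𝕜) (K := {x, y})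
    (Set.toFinite _).isBounded (ε := |x - y| / 4) (by positivity) 0 (coordinate 𝕜)
  -- For `n ≥ 1` the function `f ∘ ψ_n` cannot separate `x` from `y`, whereas a function near the
  -- identity does.
  obtain ⟨n, ⟨f, -, g, hg, hgf⟩, hn⟩ := ((hmix.exists_comp isOpen_univ ⟨0, trivial⟩ hV
    ⟨_, hV0⟩).and (eventually_ge_atTop 1)).exists
  have h1 : ‖g.1 x - (x : 𝕜)‖ ≤ |x - y| / 4 := hVg g hg 0 le_rfl x (by simp)
  have h2 : ‖g.1 y - (y : 𝕜)‖ ≤ |x - y| / 4 := hVg g hg 0 le_rfl y (by simp)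
  have h3 : g.1 x = g.1 y := by
    obtain ⟨k, rfl⟩ := Nat.exists_eq_add_of_le' hn
    simp only [hgf, Function.comp_apply, Function.iterate_succ, hxy]
  have h4 := norm_sub_le (g.1 y - (y : 𝕜)) (g.1 x - (x : 𝕜))
  rw [h3, sub_sub_sub_cancel_left, ← RCLike.ofReal_sub, RCLike.norm_ofReal] at h4
  rw [h3] at h1
  linarith

lemma iteratedDeriv_clm_comp {E F : Type*} [NormedAddCommGroup E] [NormedSpace ℝ E]
    [NormedAddCommGroup F] [NormedSpace ℝ F] (L : E →L[ℝ] F) {f : ℝ → E} {i : ℕ} {x : ℝ}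
    (hf : ContDiffAt ℝ i f x) : iteratedDeriv i (L ∘ f) x = L (iteratedDeriv i f x) := by
  rw [iteratedDeriv_eq_iteratedFDeriv, iteratedDeriv_eq_iteratedFDeriv,
    L.iteratedFDeriv_comp_left hf le_rfl]
  rfl

lemma iteratedDeriv_coordinate (i : ℕ) (x : ℝ) :
    iteratedDeriv i (coordinate 𝕜).1 x = ((iteratedDeriv i id x : ℝ) : 𝕜) :=
  iteratedDeriv_clm_comp (RCLike.ofRealCLM (K := 𝕜)) (f := id) contDiff_id.contDiffAt

lemma IsMixing.deriv_ne_zero {hψ : ψ ∈ multiplierSubmodule ℝ} (hmix : IsMixing (compOp 𝕜 ψ hψ))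
    (x : ℝ) : deriv ψ x ≠ 0 := by
  intro hx
  obtain ⟨V, hV, hV0, hVg⟩ := exists_isOpen_closeOn (𝕜 := 𝕜) (K := {x})
    Bornology.isBounded_singleton (ε := 1 / 2) (by norm_num) 1 (coordinate 𝕜)
  obtain ⟨n, ⟨f, -, g, hg, hgf⟩, hn⟩ := ((hmix.exists_comp isOpen_univ ⟨0, trivial⟩ hV
    ⟨_, hV0⟩).and (eventually_ge_atTop 1)).exists
  have h1 := hVg g hg 1 le_rfl x rfl
  rw [iteratedDeriv_coordinate] at h1
  have h2 : deriv g.1 x = 0 := by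
    obtain ⟨k, rfl⟩ := Nat.exists_eq_add_of_le' hn
    rw [hgf, Function.iterate_succ, ← Function.comp_assoc]
    have hs := contDiff_of_mem hψ
    have hd : DifferentiableAt ℝ (f.1 ∘ ψ^[k]) (ψ x) :=
      (f.contDiff.comp (contDiff_iterate hs k)).differentiable (by simp) _
    have := hd.hasDerivAt.scomp x (hs.differentiable (by simp) x).hasDerivAt
    rw [this.deriv, hx, zero_smul]
  rw [iteratedDeriv_one, iteratedDeriv_one, h2] at h1
  simp at h1
  norm_num at h1

/-- A bound for the derivatives of `φ` in terms of those of `f = g ∘ φ` when `g` is close to the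
identity. -/
lemma exists_bound_iteratedDeriv_of_comp_eq (k : ℕ) :
    ∃ A > 0, ∀ (f g φ : ℝ → ℝ) (y B D : ℝ), ContDiff ℝ ∞ f → ContDiff ℝ ∞ g →
      ContDiffAt ℝ ∞ φ y → f =ᶠ[𝓝 y] g ∘ φ →
      (∀ i ≤ k + 1, |iteratedDeriv i g (φ y) - iteratedDeriv i id (φ y)| ≤ 1 / 2) →
      1 ≤ D → (∀ i, 1 ≤ i → i ≤ k → |iteratedDeriv i φ y| ≤ D) →
      (∀ i ≤ k + 1, |iteratedDeriv i f y| ≤ B) →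
      |iteratedDeriv (k + 1) φ y| ≤ A * (B * D ^ k) := by
  obtain ⟨C, hC1, hC⟩ := exists_bound_iteratedDeriv_of_isCompact (f := fun u : ℝ => u⁻¹)
    (K := Set.Icc (1 / 2) (3 / 2)) isCompact_Icc
    (fun u hu => contDiffAt_inv ℝ (by linarith [hu.1])) k
  have hC0 : 0 < C := by linarith
  -- `k! C 2ᵏ` bounds the derivatives of `1 / g'`, the outer `k!` comes from composing with `φ`, and
  -- `2ᵏ` from the Leibniz rule.
  refine ⟨2 ^ k * (k.factorial * (k.factorial * C * 2 ^ k)), by positivity, ?_⟩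
  intro f g φ y B D hf hg hφ hfg hgi hD hφi hB
  have hB0 : 0 ≤ B := (abs_nonneg _).trans (hB 0 (Nat.zero_le _))
  have hdg : ContDiff ℝ ∞ (deriv g) := (contDiff_infty_iff_deriv.mp hg).2
  have hdf : ContDiff ℝ ∞ (deriv f) := (contDiff_infty_iff_deriv.mp hf).2
  have hg1 : deriv g (φ y) ∈ Set.Icc (1 / 2 : ℝ) (3 / 2) := by
    have := abs_le.mp (hgi 1 (by omega))
    rw [iteratedDeriv_one, iteratedDeriv_one, deriv_id] at this
    constructor <;> linarith [this.1, this.2]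
  have hg0 : deriv g (φ y) ≠ 0 := by linarith [hg1.1]
  let q : ℝ → ℝ := (fun u : ℝ => u⁻¹) ∘ deriv g
  have hq : ContDiffAt ℝ ∞ q (φ y) :=
    (contDiffAt_inv ℝ hg0).comp (φ y) hdg.contDiffAt
  have hle : ∀ {i : ℕ}, ((i : ℕ) : ℕ∞ω) ≤ ∞ := by exact_mod_cast le_top
  have hqb : ∀ l ≤ k, ‖iteratedDeriv l q (φ y)‖ ≤ k.factorial * C * 2 ^ k := by
    intro l hl
    have h1 := norm_iteratedDeriv_comp_le (n := l) (g := fun u : ℝ => u⁻¹) (f := deriv g)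
      (x := φ y) (C := C) (D := 2) (contDiffAt_inv ℝ hg0) (hdg.contDiffAt.of_le hle)
      (fun i hi => hC i (hi.trans hl) _ hg1)
      (fun i hi1 hi => by
        rw [← iteratedDeriv_succ', Real.norm_eq_abs]
        have h := hgi (i + 1) (by omega)
        rw [iteratedDeriv_id, if_neg (by omega), if_neg (by omega), sub_zero] at h
        linarith [one_le_pow₀ (n := i) (one_le_two (α := ℝ))])
    refine h1.trans ?_
    gcongr
    exact one_le_two
  have hqφ : ∀ l ≤ k, ‖iteratedDeriv l (q ∘ φ) y‖ ≤
      k.factorial * (k.factorial * C * 2 ^ k) * D ^ k := by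
    intro l hl
    have h1 := norm_iteratedDeriv_comp_le (n := l) (g := q) (f := φ) (x := y)
      (C := k.factorial * C * 2 ^ k) (D := D) (hq.of_le hle) (hφ.of_le hle)
      (fun i hi => hqb i (hi.trans hl))
      (fun i hi1 hi => (hφi i hi1 (hi.trans hl)).trans (le_self_pow₀ hD (by omega)))
    refine h1.trans ?_
    gcongr
  -- Differentiating this identity `k` times involves only derivatives of `φ` up to order `k` on the
  -- right, which is what permits induction.
  have hloc : deriv φ =ᶠ[𝓝 y] deriv f * (q ∘ φ) := by
    have hne : ∀ᶠ z in 𝓝 y, deriv g (φ z) ≠ 0 :=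
      (hdg.continuous.continuousAt.comp hφ.continuousAt).eventually_ne hg0
    have hdiff : ∀ᶠ z in 𝓝 y, ContDiffAt ℝ 1 φ z :=
      (hφ.of_le (by exact_mod_cast le_top)).eventually (by simp)
    filter_upwards [hne, hdiff, hfg.eventuallyEq_nhds] with z hz hφz hfz
    rw [Pi.mul_apply, hfz.deriv_eq, deriv_comp z (hg.differentiable (by simp) _)
      (hφz.differentiableAt (by simp))]
    simp only [q, Function.comp_apply]
    field_simp
  rw [iteratedDeriv_succ', hloc.iteratedDeriv_eq, ← Real.norm_eq_abs]
  refine (norm_iteratedDeriv_mul_le_of_le (hdf.contDiffAt.of_le hle)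
    ((hq.comp y hφ).of_le hle) (B := B) (fun i hi => ?_) hqφ).trans_eq (by ring)
  rw [← iteratedDeriv_succ']
  exact hB (i + 1) (by omega)

lemma IsMixing.polynomialGrowth {hψ : ψ ∈ multiplierSubmodule ℝ}
    (hmix : IsMixing (compOp 𝕜 ψ hψ)) (hesc : ∀ R : ℝ, ∀ᶠ n in atTop, ∀ x, R ≤ |ψ^[n] x|)
    {K : Set ℝ} (hK : Bornology.IsBounded K) : PolynomialGrowth ψ K := by
  have hs := contDiff_of_mem hψ
  have hinj := hmix.injective
  have hd := hmix.deriv_ne_zero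
  have hle : ∀ {i : ℕ}, ((i : ℕ) : ℕ∞ω) ≤ ∞ := by exact_mod_cast le_top
  intro k
  induction k using Nat.strong_induction_on with
  | _ k ih =>
  intro hk
  obtain ⟨k, rfl⟩ := Nat.exists_eq_add_of_le' hk
  obtain ⟨N, hN⟩ := exists_uniform_growth (k := k) fun i h1 hi => ih i (by omega) h1
  obtain ⟨A, hA, hbound⟩ := exists_bound_iteratedDeriv_of_comp_eq k
  obtain ⟨V, hV, hV0, hVg⟩ := exists_isOpen_closeOn (𝕜 := 𝕜) hK (ε := 1 / 2) (by norm_num)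
    (k + 1) (coordinate 𝕜)
  -- Dividing by the polynomial already known from the lower orders leaves a family bounded by 1
  -- against every Schwartz weight.
  obtain ⟨M, hM⟩ := exists_polynomial_bound (𝕜 := 𝕜) (S := fun n => ψ^[n] '' K)
    (F := fun n y => |iteratedDeriv (k + 1) (negIterate ψ n) y| / (A * (1 + |y| ^ 2) ^ (N * k)))
    (fun R => (hesc R).mono fun n hn => by
      rintro _ ⟨x, -, rfl⟩
      exact hn x)
    (fun v => by
      obtain ⟨U, hU, hU0, hUf⟩ := exists_isOpen_weight (𝕜 := 𝕜) (rapidDecay_schwartz v) (k + 1) 0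
      filter_upwards [hmix.exists_comp hU ⟨_, hU0⟩ hV ⟨_, hV0⟩, hN] with n hn hNn
      obtain ⟨f, hf, g, hg, hgf⟩ := hn
      rintro _ ⟨x, hx, rfl⟩
      rcases (norm_nonneg (v (ψ^[n] x))).eq_or_lt with h0 | h0
      · rw [← h0, zero_mul]
        exact zero_le_one
      have hback := negIterate_iterate hinj n x
      -- Since `ψ_{-n}` is real-valued, taking real parts preserves `f = g ∘ ψ_{-n}`; the weight
      -- gives `|f⁽ⁱ⁾| ≤ 1 / ‖v‖`.
      have hb := hbound (RCLike.reCLM ∘ f.1) (RCLike.reCLM ∘ g.1) (negIterate ψ n) (ψ^[n] x)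
        (‖v (ψ^[n] x)‖⁻¹) ((1 + |ψ^[n] x| ^ 2) ^ N)
        ((RCLike.reCLM (K := 𝕜)).contDiff.comp f.contDiff)
        ((RCLike.reCLM (K := 𝕜)).contDiff.comp g.contDiff)
        (contDiffAt_negIterate hs hinj hd n x)
        (by
          filter_upwards [(isOpen_range_iterate hs hd n).mem_nhds (Set.mem_range_self x)]
          rintro _ ⟨z, rfl⟩
          simp only [Function.comp_apply, negIterate_iterate hinj, hgf])
        (fun i hi => by
          rw [hback, iteratedDeriv_clm_comp _ (g.contDiff.of_le hle).contDiffAt]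
          have h1 := hVg g hg i hi x hx
          rw [iteratedDeriv_coordinate] at h1
          refine le_trans ?_ h1
          have h2 := RCLike.abs_re_le_norm
            (iteratedDeriv i g.1 x - ((iteratedDeriv i id x : ℝ) : 𝕜))
          rwa [map_sub, RCLike.ofReal_re] at h2)
        (one_le_pow₀ (by nlinarith [sq_nonneg |ψ^[n] x|]))
        (fun i h1 hi => hNn x hx i h1 hi)
        (fun i hi => by
          rw [iteratedDeriv_clm_comp _ (f.contDiff.of_le hle).contDiffAt]
          have h1 := hUf f hf i hi (ψ^[n] x)
          rw [abs_norm, mul_comm, ← le_div_iff₀ h0, one_div] at h1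
          refine (RCLike.abs_re_le_norm _).trans (le_trans (le_of_eq ?_) h1)
          have hz : iteratedDeriv i (0 : OM 𝕜).1 (ψ^[n] x) = 0 := by
            change iteratedDeriv i (fun _ : ℝ => (0 : 𝕜)) (ψ^[n] x) = 0
            simp
          rw [hz, sub_zero])
      rw [← mul_div_assoc, div_le_one (by positivity)]
      calc ‖v (ψ^[n] x)‖ * |iteratedDeriv (k + 1) (negIterate ψ n) (ψ^[n] x)|
          ≤ ‖v (ψ^[n] x)‖ * (A * (‖v (ψ^[n] x)‖⁻¹ * ((1 + |ψ^[n] x| ^ 2) ^ N) ^ k)) := by gcongr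
        _ = A * (1 + |ψ^[n] x| ^ 2) ^ (N * k) := by
          rw [pow_mul]
          field_simp)
  obtain ⟨N', hN'⟩ := eventually_const_mul_le hesc A (N * k + M)
  refine ⟨N', ?_⟩
  filter_upwards [hM, hN'] with n hn hn' x hx
  have h1 := hn _ ⟨x, hx, rfl⟩
  rw [div_le_iff₀ (by positivity)] at h1
  refine h1.trans (le_trans (le_of_eq ?_) (hn' x))
  rw [pow_add]
  ring

end Mixing

/-! ### Density of compactly supported functions and construction of mixing orbits. -/

section Sufficiency

variable {𝕜 : Type*} [RCLike 𝕜] {ψ : ℝ → ℝ}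

/-- A multiplier from a smooth compactly supported function. -/
def OM.ofCompactSupport {f : ℝ → 𝕜} (h₁ : HasCompactSupport f) (h₂ : ContDiff ℝ ∞ f) : OM 𝕜 :=
  ⟨f, mem_multiplierSubmodule_iff_hasTemperateGrowth.mpr (h₁.hasTemperateGrowth h₂)⟩

/-- One power beyond the growth exponent gains a factor at most `1 / R` on the region `|x| ≥ R`, the
only place where the derivatives can be nonzero. -/
lemma weighted_le_of_iteratedDeriv_le {f : ℝ → 𝕜} {m N : ℕ} {C R ε : ℝ} (hε : 0 < ε)
    (hR : 1 ≤ R) (hCR : C / ε ≤ R)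
    (hsmall : ∀ x, |x| < R → ∀ i ≤ m, iteratedDeriv i f x = 0)
    (hlarge : ∀ x, R ≤ |x| → ∀ i ≤ m, ‖iteratedDeriv i f x‖ ≤ C * (1 + |x| ^ 2) ^ N)
    (p : ℝ × Fin (m + 1)) : weighted m (N + 1) f p ≤ ε := by
  obtain ⟨x, i⟩ := p
  have hi : (i : ℕ) ≤ m := Nat.lt_succ_iff.mp i.2
  simp only [weighted]
  rcases lt_or_ge |x| R with hx | hx
  · rw [hsmall x hx i hi, norm_zero, mul_zero]
    exact hε.le
  · rw [inv_mul_le_iff₀ (by positivity)]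
    refine (hlarge x hx i hi).trans ?_
    rw [div_le_iff₀ hε] at hCR
    have hRx : R ≤ 1 + |x| ^ 2 := by nlinarith
    have : C ≤ (1 + |x| ^ 2) * ε := hCR.trans (by gcongr)
    calc C * (1 + |x| ^ 2) ^ N ≤ (1 + |x| ^ 2) * ε * (1 + |x| ^ 2) ^ N := by gcongr
      _ = _ := by ring

lemma norm_iteratedDeriv_le_of_weighted_le {f : ℝ → 𝕜} {m n : ℕ} {A : ℝ}
    (hA : ∀ p, weighted m n f p ≤ A) {i : ℕ} (hi : i ≤ m) (x : ℝ) :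
    ‖iteratedDeriv i f x‖ ≤ (1 + |x| ^ 2) ^ n * A := by
  have h := hA (x, ⟨i, Nat.lt_succ_iff.mpr hi⟩)
  rwa [weighted, inv_mul_le_iff₀ (by positivity)] at h

/-- The compactly supported functions are dense in `𝒪_M(ℝ)`. -/
lemma exists_hasCompactSupport_mem {U : Set (OM 𝕜)} (hU : IsOpen U) (hU' : U.Nonempty) :
    ∃ f ∈ U, HasCompactSupport f.1 := by
  obtain ⟨f, hf⟩ := hU'
  let b : ContDiffBump (0 : ℝ) := ⟨1, 2, one_pos, by norm_num⟩
  let χ : ℝ → 𝕜 := fun x => ((b x : ℝ) : 𝕜)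
  have hχs : HasCompactSupport χ := b.hasCompactSupport.comp_left RCLike.ofReal_zero
  have hχ : ContDiff ℝ ∞ χ := (RCLike.ofRealCLM (K := 𝕜)).contDiff.comp b.contDiff
  have hle : ∀ {i : ℕ}, ((i : ℕ) : ℕ∞ω) ≤ ∞ := by exact_mod_cast le_top
  let c : ℕ → ℝ := fun k => ((k : ℝ) + 1)⁻¹
  have hc0 : ∀ k, 0 < c k := fun k => by positivity
  have hc1 : ∀ k, c k ≤ 1 := fun k => inv_le_one_of_one_le₀ (by simp)
  have hcomp : ∀ k, ContDiff ℝ ∞ fun x => χ (c k • x) := fun k =>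
    hχ.comp (contDiff_const_smul (c k))
  have hus : ∀ k, HasCompactSupport ((fun x => χ (c k • x)) * f.1) := fun k =>
    (hχs.comp_smul (hc0 k).ne').mul_right
  let u : ℕ → OM 𝕜 := fun k => OM.ofCompactSupport (hus k) ((hcomp k).mul f.contDiff)
  have hlim : Tendsto u atTop (𝓝 f) := by
    refine tendsto_of_weighted fun m => ?_
    obtain ⟨n, -, A, hA⟩ := mem_multiplierSubmodule.mp f.2 m
    have hfA : ∀ i ≤ m, ∀ x, ‖iteratedDeriv i f.1 x‖ ≤ (1 + |x| ^ 2) ^ n * A := fun i hi x =>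
      norm_iteratedDeriv_le_of_weighted_le (fun p => hA ⟨p, rfl⟩) hi x
    have hA0 : 0 ≤ A := (weighted_nonneg _ _ _ _).trans (hA ⟨(0, 0), rfl⟩)
    -- The cut-off error is `d(c_k x) f(x)`. It vanishes for `|x| < k + 1`, and dilation by `c_k ≤
    -- 1` does not increase the bounds on the derivatives of `d`.
    let d : ℝ → 𝕜 := fun x => χ x - 1
    have hd : ContDiff ℝ ∞ d := hχ.sub contDiff_const
    have hM : ∃ M, 1 ≤ M ∧ ∀ i ≤ m, ∀ x, ‖iteratedDeriv i d x‖ ≤ M := by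
      obtain ⟨M, hM1, hM⟩ := exists_bound_iteratedDeriv_of_isCompact (f := d)
        (K := Metric.closedBall 0 3) (isCompact_closedBall _ _) (fun x _ => hd.contDiffAt) m
      refine ⟨M, hM1, fun i hi x => ?_⟩
      rcases le_or_gt ‖x‖ 3 with hx | hx
      · exact hM i hi x (by simpa using hx)
      · have hloc : d =ᶠ[𝓝 x] fun _ => -1 := by
          filter_upwards [continuous_norm.continuousAt.eventually_const_lt hx] with y hy
          have : b y = 0 := b.zero_of_le_dist (by
            rw [dist_zero_right]
            change (2 : ℝ) ≤ ‖y‖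
            linarith)
          simp [d, χ, this]
        rw [hloc.iteratedDeriv_eq, iteratedDeriv_const]
        split_ifs
        · simpa using hM1
        · simpa using zero_le_one.trans hM1
    obtain ⟨M, hM1, hM⟩ := hM
    have hdiff : ∀ k, (u k).1 - f.1 = (fun x => d (c k • x)) * f.1 := fun k => by
      funext x
      change χ (c k • x) * f.1 x - f.1 x = (χ (c k • x) - 1) * f.1 x
      ring
    have hdk : ∀ k, ContDiff ℝ ∞ fun x => d (c k • x) := fun k =>
      hd.comp (contDiff_const_smul (c k))
    refine ⟨n + 1, fun ε hε => ?_⟩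
    obtain ⟨k₀, hk₀⟩ := exists_nat_ge (2 ^ m * (M * A) / ε)
    filter_upwards [eventually_ge_atTop k₀] with k hk
    refine weighted_le_of_iteratedDeriv_le (C := 2 ^ m * (M * A)) (R := k + 1) hε (by simp)
      (hk₀.trans ?_) (fun x hx i _ => ?_) (fun x _ i hi => ?_)
    · have : (k₀ : ℝ) ≤ k := by exact_mod_cast hk
      linarith
    · have hloc : (u k).1 - f.1 =ᶠ[𝓝 x] fun _ => 0 := by
        filter_upwards [continuous_abs.continuousAt.eventually_lt_const hx] with y hy
        have : b (c k • y) = 1 := b.one_of_mem_closedBall (by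
          rw [mem_closedBall_zero_iff, norm_smul, Real.norm_of_nonneg (hc0 k).le]
          change (k + 1 : ℝ)⁻¹ * |y| ≤ 1
          rw [inv_mul_le_iff₀ (by positivity), mul_one]
          exact hy.le)
        simp only [hdiff, Pi.mul_apply, d, χ, this]
        simp
      rw [hloc.iteratedDeriv_eq]
      simp
    · rw [hdiff]
      have h1 := norm_iteratedDeriv_mul_le_of_le (n := i) (x := x)
        ((hdk k).of_le hle).contDiffAt (f.contDiff.of_le hle).contDiffAt (B := M)
        (C := (1 + |x| ^ 2) ^ n * A)
        (fun l hl => by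
          simp only [smul_eq_mul]
          rw [iteratedDeriv_comp_const_smul (hd.of_le hle), norm_smul, norm_pow, Real.norm_of_nonneg (hc0 k).le]
          have := hM l (hl.trans hi) (c k * x)
          calc c k ^ l * ‖iteratedDeriv l d (c k * x)‖ ≤ 1 * M := by
                gcongr
                exact pow_le_one₀ (hc0 k).le (hc1 k)
            _ = M := one_mul M)
        (fun l hl => hfA l (hl.trans hi) x)
      refine h1.trans ?_
      calc (2 : ℝ) ^ i * (M * ((1 + |x| ^ 2) ^ n * A))
          ≤ 2 ^ m * (M * ((1 + |x| ^ 2) ^ n * A)) := by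
            gcongr
            exact one_le_two
        _ = _ := by ring
  obtain ⟨k, hk⟩ := (hlim.eventually_mem (hU.mem_nhds hf)).exists
  exact ⟨u k, hk, hus k⟩

lemma extend_eventuallyEq_comp_negIterate (hψ : ContDiff ℝ ∞ ψ) (hinj : Function.Injective ψ)
    (hd : ∀ x, deriv ψ x ≠ 0) (g : ℝ → 𝕜) (n : ℕ) (x : ℝ) :
    Function.extend ψ^[n] g 0 =ᶠ[𝓝 (ψ^[n] x)] g ∘ negIterate ψ n := by
  filter_upwards [(isOpen_range_iterate hψ hd n).mem_nhds (Set.mem_range_self x)]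
  rintro _ ⟨z, rfl⟩
  rw [(hinj.iterate n).extend_apply, Function.comp_apply, negIterate_iterate hinj]

lemma extend_eventuallyEq_zero (hψ : Continuous ψ) (hinj : Function.Injective ψ) {g : ℝ → 𝕜}
    (hg : HasCompactSupport g) (n : ℕ) {y : ℝ} (hy : y ∉ ψ^[n] '' tsupport g) :
    Function.extend ψ^[n] g 0 =ᶠ[𝓝 y] fun _ => 0 := by
  filter_upwards [(hg.isCompact.image (hψ.iterate n)).isClosed.isOpen_compl.mem_nhds hy] with z hz
  by_cases h : z ∈ Set.range ψ^[n]
  · obtain ⟨s, rfl⟩ := h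
    rw [(hinj.iterate n).extend_apply]
    exact image_eq_zero_of_notMem_tsupport fun hs => hz ⟨s, hs, rfl⟩
  · exact Function.extend_apply' _ _ _ h

lemma hasCompactSupport_extend (hψ : Continuous ψ) (hinj : Function.Injective ψ) {g : ℝ → 𝕜}
    (hg : HasCompactSupport g) (n : ℕ) : HasCompactSupport (Function.extend ψ^[n] g 0) :=
  .intro (hg.isCompact.image (hψ.iterate n)) fun _ hy =>
    (extend_eventuallyEq_zero hψ hinj hg n hy).eq_of_nhds

/-- The compact set `ψ_n(supp g)` lies inside the open range of `ψ_n`, so no singularity arises at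
the boundary of the range. -/
lemma contDiff_extend (hψ : ContDiff ℝ ∞ ψ) (hinj : Function.Injective ψ)
    (hd : ∀ x, deriv ψ x ≠ 0) {g : ℝ → 𝕜} (hg : HasCompactSupport g) (hgs : ContDiff ℝ ∞ g)
    (n : ℕ) : ContDiff ℝ ∞ (Function.extend ψ^[n] g 0) := by
  refine contDiff_iff_contDiffAt.mpr fun y => ?_
  by_cases hy : y ∈ ψ^[n] '' tsupport g
  · obtain ⟨x, -, rfl⟩ := hy
    exact (hgs.contDiffAt.comp _ (contDiffAt_negIterate hψ hinj hd n x)).congr_of_eventuallyEq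
      (extend_eventuallyEq_comp_negIterate hψ hinj hd g n x)
  · exact contDiffAt_const.congr_of_eventuallyEq
      (extend_eventuallyEq_zero hψ.continuous hinj hg n hy)

/-- Under polynomial growth, the functions `g ∘ ψ_{-n}` tend to zero. -/
lemma exists_eventually_weighted_extend_le (hψ : ContDiff ℝ ∞ ψ) (hinj : Function.Injective ψ)
    (hd : ∀ x, deriv ψ x ≠ 0) (hesc : ∀ R : ℝ, ∀ᶠ n in atTop, ∀ x, R ≤ |ψ^[n] x|)
    {g : ℝ → 𝕜} (hg : HasCompactSupport g) (hgs : ContDiff ℝ ∞ g)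
    (hgrow : PolynomialGrowth ψ (tsupport g)) (m : ℕ) :
    ∃ N, ∀ ε > 0, ∀ᶠ n in atTop, ∀ p, weighted m N (Function.extend ψ^[n] g 0) p ≤ ε := by
  obtain ⟨N, hN⟩ := exists_uniform_growth (k := m) fun i h1 _ => hgrow i h1
  obtain ⟨C, hC1, hC⟩ := exists_bound_iteratedDeriv_of_isCompact hg.isCompact
    (fun x _ => hgs.contDiffAt) m
  have hle : ∀ {i : ℕ}, ((i : ℕ) : ℕ∞ω) ≤ ∞ := by exact_mod_cast le_top
  -- `N * m` comes from composing up to `m` derivatives; the extra 1 yields smallness, as the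
  -- support escapes.
  refine ⟨N * m + 1, fun ε hε => ?_⟩
  filter_upwards [hN, hesc (max 1 (m.factorial * C / ε))] with n hn hR
  have hzero : ∀ y ∉ ψ^[n] '' tsupport g, ∀ i,
      iteratedDeriv i (Function.extend ψ^[n] g 0) y = 0 := fun y hy i => by
    rw [(extend_eventuallyEq_zero hψ.continuous hinj hg n hy).iteratedDeriv_eq]
    simp
  refine weighted_le_of_iteratedDeriv_le (C := m.factorial * C) hε (le_max_left _ _)
    (le_max_right _ _) (fun y hy i _ => hzero y ?_ i) (fun y _ i hi => ?_)
  · rintro ⟨x, -, rfl⟩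
    exact absurd (hR x) hy.not_ge
  · by_cases hy : y ∈ ψ^[n] '' tsupport g
    · obtain ⟨x, hx, rfl⟩ := hy
      rw [(extend_eventuallyEq_comp_negIterate hψ hinj hd g n x).iteratedDeriv_eq]
      have h1 : (1 : ℝ) ≤ 1 + |ψ^[n] x| ^ 2 := by nlinarith [sq_nonneg |ψ^[n] x|]
      have hback := negIterate_iterate hinj n x
      refine (norm_iteratedDeriv_comp_le (C := C) (D := (1 + |ψ^[n] x| ^ 2) ^ N)
        (hgs.of_le hle).contDiffAt ((contDiffAt_negIterate hψ hinj hd n x).of_le hle)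
        (fun l hl => by rw [hback]; exact hC l (hl.trans hi) x hx)
        (fun l hl1 hl => (hn x hx l hl1 (hl.trans hi)).trans
          (le_self_pow₀ (one_le_pow₀ h1) (by omega)))).trans ?_
      rw [← pow_mul]
      gcongr
    · rw [hzero y hy, norm_zero]
      positivity

lemma isMixing_of_polynomialGrowth (hψ : ψ ∈ multiplierSubmodule ℝ)
    (hinj : Function.Injective ψ) (hd : ∀ x, deriv ψ x ≠ 0)
    (hesc : ∀ R : ℝ, ∀ᶠ n in atTop, ∀ x, R ≤ |ψ^[n] x|)
    (hgrow : ∀ K : Set ℝ, IsCompact K → PolynomialGrowth ψ K) :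
    IsMixing (compOp 𝕜 ψ hψ) := by
  intro U V hU hU' hV hV'
  have hs := contDiff_of_mem hψ
  obtain ⟨f, hfU, hf⟩ := exists_hasCompactSupport_mem hU hU'
  obtain ⟨g, hgV, hg⟩ := exists_hasCompactSupport_mem hV hV'
  let S : ℕ → OM 𝕜 := fun n => OM.ofCompactSupport
    (hasCompactSupport_extend hs.continuous hinj hg n) (contDiff_extend hs hinj hd hg g.contDiff n)
  have hlim : Tendsto (fun n => f + S n) atTop (𝓝 f) := by
    refine tendsto_of_weighted fun m => ?_
    obtain ⟨N, hN⟩ := exists_eventually_weighted_extend_le hs hinj hd hesc hg g.contDiff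
      (hgrow _ hg.isCompact) m
    refine ⟨N, fun ε hε => (hN ε hε).mono fun n hn => ?_⟩
    have : (f + S n).1 - f.1 = Function.extend ψ^[n] g.1 0 := add_sub_cancel_left f.1 _
    rwa [this]
  obtain ⟨R, hR⟩ := hf.isCompact.isBounded.exists_norm_le
  -- Once `ψ_n` maps the whole line beyond the support of `f`, `f ∘ ψ_n` vanishes identically and
  -- the image is exactly `g`.
  have hev : ∀ᶠ n in atTop, f + S n ∈ U ∧ ∀ x, R + 1 ≤ |ψ^[n] x| :=
    (hlim.eventually_mem (hU.mem_nhds hfU)).and (hesc (R + 1))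
  obtain ⟨N, hN⟩ := eventually_atTop.mp hev
  refine ⟨N, fun n hn => ?_⟩
  obtain ⟨hmem, hfar⟩ := hN n hn
  refine ⟨_, ⟨f + S n, hmem, rfl⟩, ?_⟩
  convert hgV
  refine Subtype.ext ?_
  rw [compOp_iterate_apply]
  funext x
  have h0 : f.1 (ψ^[n] x) = 0 := image_eq_zero_of_notMem_tsupport fun hx => by
    have h1 := hR _ hx
    rw [Real.norm_eq_abs] at h1
    linarith [hfar x]
  change f.1 (ψ^[n] x) + Function.extend ψ^[n] g.1 0 (ψ^[n] x) = g.1 x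
  rw [h0, zero_add, (hinj.iterate n).extend_apply]

end Sufficiency

end MultiplierSpace

end

theorem theorem3p6 {𝕜 : Type*} [RCLike 𝕜] (ψ : ℝ → ℝ)
    (hψ : ψ ∈ MultiplierSpace.multiplierSubmodule ℝ) (hns : ¬ Function.Surjective ψ) :
    List.TFAE [
      MultiplierSpace.IsMixing (MultiplierSpace.compOp 𝕜 ψ hψ),
      Function.Injective ψ ∧ (∀ x, deriv ψ x ≠ 0) ∧ (∀ x, ψ x ≠ x) ∧
        ∀ a : ℝ, MultiplierSpace.InverseIteratesDecay 𝕜 ψ a,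
      Function.Injective ψ ∧ (∀ x, deriv ψ x ≠ 0) ∧ (∀ x, ψ x ≠ x) ∧
        ∃ a : ℝ, MultiplierSpace.InverseIteratesDecay 𝕜 ψ a] := by
  have hs := MultiplierSpace.contDiff_of_mem hψ
  tfae_have 1 → 2 := fun hmix => by
    have hinj := hmix.injective
    have hesc := MultiplierSpace.eventually_le_abs_iterate hs.continuous hinj hmix.no_fixed hns
    exact ⟨hinj, hmix.deriv_ne_zero, hmix.no_fixed, fun a =>
      (MultiplierSpace.inverseIteratesDecay_iff hs hmix.deriv_ne_zero hesc a).mpr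
        (hmix.polynomialGrowth hesc isCompact_uIcc.isBounded)⟩
  tfae_have 2 → 3 := fun ⟨hinj, hd, hfix, h⟩ => ⟨hinj, hd, hfix, 0, h 0⟩
  tfae_have 3 → 1 := fun ⟨hinj, hd, hfix, a, ha⟩ => by
    have hesc := MultiplierSpace.eventually_le_abs_iterate hs.continuous hinj hfix hns
    refine MultiplierSpace.isMixing_of_polynomialGrowth hψ hinj hd hesc fun K hK => ?_
    exact ((MultiplierSpace.inverseIteratesDecay_iff hs hd hesc a).mp ha).of_uIcc
      hs hinj hd hfix hesc hK
  tfae_finish
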